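/- Let $C_{\ell,k}$ denote the graph obtained by joining $k$ cycles of length $\ell$ at one common vertex. For a fixed graph $F$ and an integer $r\ge 2$, the (edge) Achlioptas game with parameters $F$ and $r$ is the following one-player game, which starts with the empty graph on $n$ vertices. In each step, $r$ edges chosen uniformly at random from all edges of $K_n$ never seen before are revealed; knowing everything revealed so far, the player chooses exactly one of them for inclusion in the graph, and the remaining $r-1$ edges are discarded. The game ends when fewer than $r$ unseen edges remain. The player survives for at least $N$ steps if $N$ steps are played and the graph of her chosen edges contains no copy of $F$ after these $N$ steps. An eventually positive function $N_0=N_0(n)$ is a threshold function of the game if, for every $N=N(n)$ with nonnegative integer values, (i) $N=o(N_0)$ implies that some strategy makes the player survive for at least $N$ steps with probability tending to $1$ as $n\to\infty$, and (ii) $N_0=o(N)$ implies that, whatever strategy she uses, the probability that she survives for more than $N$ steps tends to $0$. (Threshold functions are determined only up to constant factors, and are compared by their orders of magnitude.) **Lemma.** For all integers $\ell\ge 3$, $k\ge 3$ and $r\ge 2$, the threshold of the Achlioptas game with parameters $C_{\ell,k}$ and $r$ is at least $$N_{\mathrm{LB}}(n)=n^{\,2-\frac{(r(\ell-2)+1)(r^k-1)+r-1}{(r(\ell-1)+1)(r^k-1)}}.$$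 That is, for every $N=N(n)$ with nonnegative integer values and $N=o(N_{\mathrm{LB}})$ there is a strategy with which the player survives for at least $N$ steps with probability tending to $1$ as $n\to\infty$; and every threshold function $N_0$ of the game satisfies $N_{\mathrm{LB}}=O(N_0)$. -/

import Mathlib

open Filter Topology Asymptotics

open scoped ENNReal

noncomputable section

/-- The graph `C_{ℓ,k}` obtained by joining `k` cycles of length `ℓ` at one common vertex
(for `ℓ ≥ 3`). The vertex `none` is the common vertex, and the `i`-th cycle is
`none, (i, 0), (i, 1), …, (i, ℓ - 2), none`. -/
def joinedCycles (ℓ k : ℕ) : SimpleGraph (Option (Fin k × Fin (ℓ - 1))) :=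
  SimpleGraph.fromRel fun x y =>
    match x, y with
    | none, some (_, a) => (a : ℕ) = 0 ∨ (a : ℕ) + 2 = ℓ
    | some (i, a), some (j, b) => i = j ∧ (a : ℕ) + 1 = (b : ℕ)
    | _, _ => False

namespace Achlioptas

/-- A record of the sets of edges of the complete graph on `n` vertices revealed so far,
the most recent one first. -/
abbrev History (n : ℕ) : Type := List (Finset (Sym2 (Fin n)))

/-- The `r`-element sets of edges never seen before, that is, the possible outcomes of the next
step after the history `h`. -/
def offers (n r : ℕ) (h : History n) : Finset (Finset (Sym2 (Fin n))) :=
  ((⊤ : SimpleGraph (Fin n)).edgeFinset.filter fun e => ∀ S ∈ h, e ∉ S).powersetCard r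

open Classical in
/-- The distribution of the history when `N` steps are to be played: in each step, `r` edges chosen
uniformly at random from all edges never seen before are revealed. Once fewer than `r` edges have
not been seen, no further step takes place. -/
def historyLaw (n r : ℕ) : ℕ → PMF (History n)
  | 0 => PMF.pure []
  | N + 1 => (historyLaw n r N).bind fun h =>
      if hne : (offers n r h).Nonempty then
        (PMF.uniformOfFinset (offers n r h) hne).map fun S => S :: h
      else PMF.pure h

/-- A strategy of the player: given the sets revealed in the previous steps and the set `S`
revealed in the current step, it selects one of the edges in `S`. -/
def Strategy (n : ℕ) : Type :=
  History n → (S : Finset (Sym2 (Fin n))) → S.Nonempty → S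

/-- The edges selected by the player along a history. -/
def chosen {n : ℕ} (σ : Strategy n) : History n → Finset (Sym2 (Fin n))
  | [] => ∅
  | S :: h => if hS : S.Nonempty then insert (σ h S hS : Sym2 (Fin n)) (chosen σ h) else chosen σ h

/-- The graph of the edges selected by the player along a history. -/
def playerGraph {n : ℕ} (σ : Strategy n) (h : History n) : SimpleGraph (Fin n) :=
  SimpleGraph.fromEdgeSet (chosen σ h : Set (Sym2 (Fin n)))

/-- The probability that the player, using the strategy `σ` in the Achlioptas game with parameters
`F` and `r` on `n` vertices, survives for at least `N` steps: `N` steps are played, and the selected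
edges contain no copy of `F` at the end of them (hence at no earlier time either). -/
def survivalProb {V : Type*} (F : SimpleGraph V) (r : ℕ) {n : ℕ} (σ : Strategy n) (N : ℕ) : ℝ≥0∞ :=
  (historyLaw n r N).toOuterMeasure {h | h.length = N ∧ F.Free (playerGraph σ h)}

/-- With an appropriate strategy the player a.a.s. survives for at least `N` steps. -/
def CanSurvive {V : Type*} (F : SimpleGraph V) (r : ℕ) (N : ℕ → ℕ) : Prop :=
  ∃ σ : ∀ n, Strategy n, Tendsto (fun n => survivalProb F r (σ n) (N n)) atTop (𝓝 1)

/-- Regardless of her strategy, the player a.a.s. does not survive for more than `N` steps. -/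
def CannotSurvive {V : Type*} (F : SimpleGraph V) (r : ℕ) (N : ℕ → ℕ) : Prop :=
  ∀ σ : ∀ n, Strategy n, Tendsto (fun n => survivalProb F r (σ n) (N n + 1)) atTop (𝓝 0)

/-- `N₀` is a threshold function of the Achlioptas game with parameters `F` and `r`. -/
structure IsThreshold {V : Type*} (F : SimpleGraph V) (r : ℕ) (N₀ : ℕ → ℝ) : Prop where
  eventually_pos : ∀ᶠ n in atTop, 0 < N₀ n
  canSurvive : ∀ N : ℕ → ℕ, (fun n => (N n : ℝ)) =o[atTop] N₀ → CanSurvive F r N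
  cannotSurvive : ∀ N : ℕ → ℕ, N₀ =o[atTop] (fun n => (N n : ℝ)) → CannotSurvive F r N

/-- The function `N_{LB-Achl}(ℓ, k, r, n)`. -/
def lowerBound (ℓ k r : ℕ) (n : ℕ) : ℝ :=
  (n : ℝ) ^ ((2 : ℝ) -
    (((r : ℝ) * ((ℓ : ℝ) - 2) + 1) * ((r : ℝ) ^ k - 1) + (r : ℝ) - 1) /
      (((r : ℝ) * ((ℓ : ℝ) - 1) + 1) * ((r : ℝ) ^ k - 1)))

end Achlioptas

end

/-!
Write the bound as `n ^ (2 - x)` with `x = lowerExponent ℓ k r`. The player uses the greedy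
strategy: the rank of an edge is the largest `b` such that selecting it creates a flower with `b`
petals (a copy of `C_{ℓ,b}`) through it, and she selects an edge of minimal rank. If a selected
edge closes the `b`-th petal of a flower, then each of the other `r - 1` edges revealed with it
would have closed the `b`-th petal of some flower as well (`isGreedyRun_greedyChosen`).

Hence a copy of `C_{ℓ,k}` forces a recursive structure in the revealed edges: the closing edge of
its `b`-th petal comes with `r - 1` further edges, each of which closes a cycle at a vertex that
already has `b - 1` petals, and so on. A `Witness` records a part of this structure. A witness
with `v` vertices and `d` selected edges, for `q` of which the whole step is included, involves
`d` steps and `d + (r - 1) q` edges. After `N` steps the expected number of such witnesses is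
therefore of order at most `n ^ v * N ^ d * n ^ (-2 (d + (r - 1) q))`
(`historyLaw_meetsPrescription_le`), and for `N = n ^ (2 - x)` this is `n` to the power
`v - x d - 2 (r - 1) q`, the exponent of the witness.

If all parts of the structure are disjoint, the exponent is `1 - (r ^ b - 1) / (r ^ k - 1)` for a
flower with `b` petals (`treeExponent_lowerExponent`), which is at least `1 / 2` for `b < k` and
vanishes for `b = k`. If the parts overlap, the exploration of the structure stops at the overlap:
a cycle that meets the rest of the witness saves so many vertices that it costs at least as much
as the whole tree-like branch (`exists_extends_of_through`). So every lost game contains a witness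
of bounded size and nonpositive exponent (`exists_witness`). There are boundedly many shapes of
such witnesses, and if `N` is of smaller order than `n ^ (2 - x)`, the expected number of copies
of each of them tends to `0` since each has at least one edge (`tendsto_expected_copies`).

The statement on threshold functions follows by comparing the two properties of a threshold along
a subsequence on which it would be much smaller than the lower bound (`IsThreshold.isBigO`).
-/

namespace Achlioptas

/-! ### Cycles and flowers -/

section Petals

variable {ℓ : ℕ} {W : Type*}

/-- The edge between positions `x` and `x + 1` of the closed walk `p` of length `ℓ`. -/
def petalEdge (p : ZMod ℓ → W) (x : ZMod ℓ) : Sym2 W := s(p x, p (x + 1))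

/-- A flower: a set of `ℓ`-cycles, parametrized by `ZMod ℓ` and based at the center `v`, any two of
which meet in `v` only. A flower with `b` petals is a copy of `C_{ℓ,b}`. -/
structure IsFlower (v : W) (P : Finset (ZMod ℓ → W)) : Prop where
  center : ∀ p ∈ P, p 0 = v
  inj : ∀ p ∈ P, Function.Injective p
  disj : ∀ p ∈ P, ∀ q ∈ P, p ≠ q → ∀ x y, p x = q y → x = 0

lemma IsFlower.mono {v : W} {P Q : Finset (ZMod ℓ → W)} (h : IsFlower v P) (hQ : Q ⊆ P) :
    IsFlower v Q :=
  ⟨fun p hp => h.center p (hQ hp), fun p hp => h.inj p (hQ hp),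
    fun p hp q hq => h.disj p (hQ hp) q (hQ hq)⟩

lemma petalEdge_injective (hℓ : 3 ≤ ℓ) {p : ZMod ℓ → W} (hp : Function.Injective p) :
    Function.Injective (petalEdge p) := by
  intro x y hxy
  rcases Sym2.eq_iff.1 hxy with ⟨h, -⟩ | ⟨h1, h2⟩
  · exact hp h
  · exfalso
    have h1 := hp h1
    have h2 := hp h2
    have h3 : (2 : ZMod ℓ) = 0 := by
      have : y + 1 + 1 = y := by rw [← h1]; exact h2
      linear_combination this
    have h4 : ((2 : ℕ) : ZMod ℓ) = 0 := by exact_mod_cast h3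
    rw [ZMod.natCast_eq_zero_iff] at h4
    have := Nat.le_of_dvd (by norm_num) h4
    omega

variable [NeZero ℓ] [DecidableEq W]

/-- The vertices of a closed walk. -/
def petalVerts (p : ZMod ℓ → W) : Finset W := Finset.univ.image p

/-- The edges of a closed walk. -/
def petalEdges (p : ZMod ℓ → W) : Finset (Sym2 W) := Finset.univ.image (petalEdge p)

/-- Adding the edge `e` to the edge set `H` creates a flower with `b` petals that uses `e`. -/
def Through (ℓ : ℕ) [NeZero ℓ] (b : ℕ) (H : Finset (Sym2 W)) (e : Sym2 W) : Prop :=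
  ∃ (v : W) (P : Finset (ZMod ℓ → W)), IsFlower v P ∧ P.card = b ∧
    (∀ p ∈ P, petalEdges p ⊆ insert e H) ∧ ∃ p ∈ P, e ∈ petalEdges p

lemma mem_petalVerts {p : ZMod ℓ → W} {w : W} : w ∈ petalVerts p ↔ ∃ x, p x = w := by
  simp [petalVerts]

lemma mem_petalEdges {p : ZMod ℓ → W} {e : Sym2 W} :
    e ∈ petalEdges p ↔ ∃ x, petalEdge p x = e := by
  simp [petalEdges]

lemma mem_petalVerts_of_mem {p : ZMod ℓ → W} {e : Sym2 W} (he : e ∈ petalEdges p) {w : W}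
    (hw : w ∈ e) : w ∈ petalVerts p := by
  obtain ⟨x, rfl⟩ := mem_petalEdges.1 he
  rcases Sym2.mem_iff.1 hw with rfl | rfl <;> exact mem_petalVerts.2 ⟨_, rfl⟩

lemma card_petalVerts {p : ZMod ℓ → W} (hp : Function.Injective p) : (petalVerts p).card = ℓ := by
  rw [petalVerts, Finset.card_image_of_injective _ hp, Finset.card_univ, ZMod.card]

lemma card_petalVerts_le (p : ZMod ℓ → W) : (petalVerts p).card ≤ ℓ :=
  Finset.card_image_le.trans (by rw [Finset.card_univ, ZMod.card])

lemma card_petalEdges (hℓ : 3 ≤ ℓ) {p : ZMod ℓ → W} (hp : Function.Injective p) :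
    (petalEdges p).card = ℓ := by
  rw [petalEdges, Finset.card_image_of_injective _ (petalEdge_injective hℓ hp), Finset.card_univ,
    ZMod.card]

/-- Distinct petals of a flower are edge-disjoint, since they share a single vertex. -/
lemma IsFlower.not_mem_petalEdges {v : W} {P : Finset (ZMod ℓ → W)} (h : IsFlower v P) (hℓ : 3 ≤ ℓ)
    {p q : ZMod ℓ → W} (hp : p ∈ P) (hq : q ∈ P) (hpq : p ≠ q) {e : Sym2 W}
    (he : e ∈ petalEdges p) : e ∉ petalEdges q := by
  intro he'
  obtain ⟨x, rfl⟩ := mem_petalEdges.1 he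
  have key : ∀ z, p z ∈ petalEdge p x → z = 0 := fun z hz => by
    obtain ⟨y, hy⟩ := mem_petalVerts.1 (mem_petalVerts_of_mem he' hz)
    exact h.disj p hp q hq hpq z y hy.symm
  have h1 := key x (Sym2.mem_mk_left _ _)
  have h2 := key (x + 1) (Sym2.mem_mk_right _ _)
  rw [h1, zero_add] at h2
  have : Fact (1 < ℓ) := ⟨by omega⟩
  exact one_ne_zero h2

/-- A proper nonempty set of vertices of a cycle is incident with more edges than it has
elements. -/
lemma card_lt_card_union_image_sub_one {Y : Finset (ZMod ℓ)} (hY : Y.Nonempty)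
    (hY' : Y ≠ Finset.univ) : Y.card + 1 ≤ (Y ∪ Y.image (· - 1)).card := by
  by_contra hlt
  have hsub : Y = Y ∪ Y.image (· - 1) :=
    Finset.eq_of_subset_of_card_le Finset.subset_union_left (by omega)
  have hcl : ∀ y ∈ Y, y - 1 ∈ Y := fun y hy => by
    rw [hsub]; exact Finset.mem_union_right _ (Finset.mem_image_of_mem _ hy)
  obtain ⟨y, hy⟩ := hY
  have hall : ∀ n : ℕ, y - n ∈ Y := by
    intro n
    induction n with
    | zero => simpa using hy
    | succ n ih =>
      have := hcl _ ih
      push_cast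
      rwa [sub_sub] at this
  apply hY'
  refine Finset.eq_univ_of_forall fun z => ?_
  have := hall (y - z).val
  rwa [ZMod.natCast_zmod_val, sub_sub_cancel] at this

lemma card_add_one_le_card_petalEdges_sdiff (hℓ : 3 ≤ ℓ) {p : ZMod ℓ → W}
    (hp : Function.Injective p) {D : Finset (Sym2 W)} {Y : Finset (ZMod ℓ)} (hY : Y.Nonempty)
    (hY' : Y ≠ Finset.univ)
    (hD : ∀ e ∈ petalEdges p, ∀ x ∈ Y, p x ∈ e → e ∉ D) :
    Y.card + 1 ≤ (petalEdges p \ D).card := by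
  refine (card_lt_card_union_image_sub_one hY hY').trans ?_
  rw [← Finset.card_image_of_injective _ (petalEdge_injective hℓ hp)]
  refine Finset.card_le_card fun e he => ?_
  obtain ⟨x, hx, rfl⟩ := Finset.mem_image.1 he
  have hm : petalEdge p x ∈ petalEdges p := mem_petalEdges.2 ⟨x, rfl⟩
  refine Finset.mem_sdiff.2 ⟨hm, ?_⟩
  rcases Finset.mem_union.1 hx with hx | hx
  · exact hD _ hm x hx (Sym2.mem_mk_left _ _)
  · obtain ⟨y, hy, rfl⟩ := Finset.mem_image.1 hx
    refine hD _ hm y hy ?_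
    simp [petalEdge]

/-- A cycle that meets a vertex set `V` but is not contained in a graph `D` on `V` has more edges
outside of `D` than vertices outside of `V`. -/
lemma card_petalVerts_sdiff_lt (hℓ : 3 ≤ ℓ) {p : ZMod ℓ → W}
    (hp : Function.Injective p) {V : Finset W} {D : Finset (Sym2 W)}
    (hD : ∀ e ∈ D, ∀ w ∈ e, w ∈ V) (hV : ∃ x, p x ∈ V) {f : Sym2 W} (hf : f ∈ petalEdges p)
    (hfD : f ∉ D) : (petalVerts p \ V).card + 1 ≤ (petalEdges p \ D).card := by
  classical
  set Y : Finset (ZMod ℓ) := Finset.univ.filter fun x => p x ∉ V with hYdef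
  have hYc : (petalVerts p \ V).card = Y.card := by
    rw [← Finset.card_image_of_injective Y hp]
    congr 1
    ext w
    simp only [Finset.mem_sdiff, mem_petalVerts, Finset.mem_image, hYdef, Finset.mem_filter,
      Finset.mem_univ, true_and]
    constructor
    · rintro ⟨⟨x, rfl⟩, h⟩; exact ⟨x, h, rfl⟩
    · rintro ⟨x, h, rfl⟩; exact ⟨⟨x, rfl⟩, h⟩
  rw [hYc]
  rcases Y.eq_empty_or_nonempty with h0 | h0
  · rw [h0, Finset.card_empty]
    exact Finset.card_pos.2 ⟨f, Finset.mem_sdiff.2 ⟨hf, hfD⟩⟩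
  · refine card_add_one_le_card_petalEdges_sdiff hℓ hp h0 ?_ ?_
    · obtain ⟨x, hx⟩ := hV
      intro h
      have : x ∈ Y := h ▸ Finset.mem_univ x
      simp [hYdef, hx] at this
    · intro e _ x hx hxe he
      simp only [hYdef, Finset.mem_filter] at hx
      exact hx.2 (hD e he _ hxe)

lemma Through.of_le {b c : ℕ} {H : Finset (Sym2 W)} {e : Sym2 W} (h : Through ℓ c H e)
    (hb : 1 ≤ b) (hbc : b ≤ c) : Through ℓ b H e := by
  obtain ⟨v, P, hP, hc, hH, p, hp, he⟩ := h
  obtain ⟨Q, hQ1, hQ2, hQ3⟩ := Finset.exists_subsuperset_card_eq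
    (Finset.singleton_subset_iff.2 hp) (by simpa using hb) (hc ▸ hbc)
  exact ⟨v, Q, hP.mono hQ2, hQ3, fun q hq => hH q (hQ2 hq), p,
    hQ1 (Finset.mem_singleton_self p), he⟩

end Petals

/-! ### Witnesses and their exponents -/

section Witness

variable {W : Type*}

/-- A partial witness: a set of vertices, a set of selected edges, and a set of selected edges that
are taken together with all the other edges revealed in the same step. -/
structure Witness (W : Type*) where
  verts : Finset W
  edges : Finset (Sym2 W)
  full : Finset (Sym2 W)

/-- The exponent of a witness: if `n ^ (2 - x)` steps are played then the number of copies of the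
witness is expected to be of order `n` to the power of the exponent. -/
def Witness.exponent (x : ℝ) (r : ℕ) (J : Witness W) : ℝ :=
  J.verts.card - x * J.edges.card - 2 * ((r : ℝ) - 1) * J.full.card

/-- The witness consists of selected edges, and its edges lie within its vertex set. The other edges
revealed together with those in `full` are not required to do so. -/
structure Witness.Valid (G : Finset (Sym2 W)) (J : Witness W) : Prop where
  edges_sub : J.edges ⊆ G
  full_sub : J.full ⊆ J.edges
  mem_verts : ∀ e ∈ J.edges, ∀ w ∈ e, w ∈ J.verts

/-- `J'` extends `J`; among the edges of `J`, only those in `X` may become full, and whenever an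
edge becomes full, all edges of its step lie within the new vertex set. -/
structure Witness.Extends (step : Sym2 W → Finset (Sym2 W)) (X : Finset (Sym2 W))
    (J J' : Witness W) : Prop where
  verts : J.verts ⊆ J'.verts
  edges : J.edges ⊆ J'.edges
  full : J.full ⊆ J'.full
  new_full : ∀ f ∈ J'.full, f ∉ J.full → f ∈ X ∨ f ∉ J.edges
  covered : ∀ f ∈ J'.full, f ∉ J.full → ∀ e ∈ step f, ∀ w ∈ e, w ∈ J'.verts

lemma Witness.Extends.refl (step : Sym2 W → Finset (Sym2 W)) (X : Finset (Sym2 W))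
    (J : Witness W) : J.Extends step X J :=
  ⟨subset_rfl, subset_rfl, subset_rfl, fun _ h h' => absurd h h', fun _ h h' => absurd h h'⟩

variable {ℓ : ℕ} [NeZero ℓ] [DecidableEq W] {r : ℕ}

/-- What the witness argument uses about a run of the game in which the player avoids flowers
greedily: `G` is the set of selected edges, `time e` is the time at which `e ∈ G` was selected and
`step e` is the set of edges revealed at that time. -/
structure IsGreedyRun (ℓ : ℕ) [NeZero ℓ] (r : ℕ) (G : Finset (Sym2 W)) (time : Sym2 W → ℕ)
    (step : Sym2 W → Finset (Sym2 W)) : Prop where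
  mem_step : ∀ e ∈ G, e ∈ step e
  card_step : ∀ e ∈ G, (step e).card = r
  disjoint : ∀ e ∈ G, ∀ f ∈ G, e ≠ f → Disjoint (step e) (step f)
  time_inj : ∀ e ∈ G, ∀ f ∈ G, time e = time f → e = f
  greedy : ∀ e ∈ G, ∀ b, Through ℓ b (G.filter fun f => time f < time e) e →
    ∀ f ∈ step e, Through ℓ b (G.filter fun g => time g < time e) f

lemma Witness.Extends.trans {step : Sym2 W → Finset (Sym2 W)} {X Y Z : Finset (Sym2 W)}
    {J J' J'' : Witness W} (h : J.Extends step X J') (h' : J'.Extends step Y J'')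
    (hX : X ⊆ Z) (hY : ∀ f ∈ Y, f ∈ Z ∨ f ∉ J.edges) : J.Extends step Z J'' := by
  refine ⟨h.verts.trans h'.verts, h.edges.trans h'.edges, h.full.trans h'.full, ?_, ?_⟩
  · intro f hf hfJ
    by_cases hf' : f ∈ J'.full
    · exact (h.new_full f hf' hfJ).imp_left (@hX f)
    · rcases h'.new_full f hf hf' with h1 | h1
      · exact hY f h1
      · exact Or.inr fun h2 => h1 (h.edges h2)
  · intro f hf hfJ e he w hw
    by_cases hf' : f ∈ J'.full
    · exact h'.verts (h.covered f hf' hfJ e he w hw)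
    · exact h'.covered f hf hf' e he w hw

/-- The exponent of the tree-like witness for a flower with `b` petals around a new vertex. Here
`1 - y` is the exponent lost by an edge. The last of the petals changes the exponent by `ℓ y - 1`,
and each of the `r - 1` other edges of its closing step closes a cycle around the center of a
separate witness for a flower with `b - 1` petals. -/
def treeExponent (ℓ r : ℕ) (y : ℝ) : ℕ → ℝ
  | 0 => 1
  | b + 1 => treeExponent ℓ r y b + (ℓ * y - 1) +
      ((r : ℝ) - 1) * (treeExponent ℓ r y b + ((ℓ : ℝ) - 1) * y - 2)

/-- A bound on the number of vertices of the witness needed to complete the closing steps of all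
petals of a flower. -/
def growth (ℓ r : ℕ) : ℕ → ℕ
  | 0 => 0
  | a + 1 => growth ℓ r a + r * ((a + 1) * ℓ + growth ℓ r a)

/-- Adding vertices and edges to a witness, without completing any steps. -/
def Witness.add (J : Witness W) (V : Finset W) (D : Finset (Sym2 W)) : Witness W :=
  ⟨J.verts ∪ V, J.edges ∪ D, J.full⟩

lemma Witness.extends_add (step : Sym2 W → Finset (Sym2 W)) (X : Finset (Sym2 W)) (J : Witness W)
    (V : Finset W) (D : Finset (Sym2 W)) : J.Extends step X (J.add V D) :=
  ⟨Finset.subset_union_left, Finset.subset_union_left, subset_rfl, fun _ h h' => absurd h h',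
    fun _ h h' => absurd h h'⟩

lemma Witness.Valid.add {G : Finset (Sym2 W)} {J : Witness W} (hJ : J.Valid G) {V : Finset W}
    {D : Finset (Sym2 W)} (hD : D ⊆ G) (hDV : ∀ e ∈ D, ∀ w ∈ e, w ∈ V) : (J.add V D).Valid G := by
  refine ⟨Finset.union_subset hJ.edges_sub hD, hJ.full_sub.trans Finset.subset_union_left, ?_⟩
  intro e he w hw
  rcases Finset.mem_union.1 he with he | he
  · exact Finset.mem_union_left _ (hJ.mem_verts e he w hw)
  · exact Finset.mem_union_right _ (hDV e he w hw)

lemma Witness.exponent_add_le {x : ℝ} (hx : 0 ≤ x) (J : Witness W) {V : Finset W}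
    {D : Finset (Sym2 W)} {a b : ℕ} (ha : (V \ J.verts).card ≤ a) (hb : b ≤ (D \ J.edges).card) :
    (J.add V D).exponent x r ≤ J.exponent x r + a - x * b := by
  have h1 : ((J.verts ∪ V).card : ℝ) = J.verts.card + (V \ J.verts).card := by
    rw [← Finset.union_sdiff_self_eq_union, Finset.card_union_of_disjoint Finset.disjoint_sdiff]
    push_cast; rfl
  have h2 : ((J.edges ∪ D).card : ℝ) = J.edges.card + (D \ J.edges).card := by
    rw [← Finset.union_sdiff_self_eq_union, Finset.card_union_of_disjoint Finset.disjoint_sdiff]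
    push_cast; rfl
  have h3 : ((V \ J.verts).card : ℝ) ≤ a := by exact_mod_cast ha
  have h4 : (b : ℝ) ≤ (D \ J.edges).card := by exact_mod_cast hb
  have h5 := mul_le_mul_of_nonneg_left h4 hx
  simp only [exponent, add]
  rw [h1, h2]
  linarith

lemma Witness.card_verts_add_le (J : Witness W) (V : Finset W) (D : Finset (Sym2 W)) :
    (J.add V D).verts.card ≤ J.verts.card + V.card := Finset.card_union_le _ _

/-- All vertices of a set of petals. -/
def flowerVerts (P : Finset (ZMod ℓ → W)) : Finset W := P.biUnion petalVerts

/-- All edges of a set of petals. -/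
def flowerEdges (P : Finset (ZMod ℓ → W)) : Finset (Sym2 W) := P.biUnion petalEdges

lemma card_flowerVerts_le (P : Finset (ZMod ℓ → W)) : (flowerVerts P).card ≤ P.card * ℓ :=
  Finset.card_biUnion_le_card_mul _ _ _ fun p _ => card_petalVerts_le p

lemma mem_flowerVerts_of_mem {P : Finset (ZMod ℓ → W)} {e : Sym2 W} (he : e ∈ flowerEdges P)
    {w : W} (hw : w ∈ e) : w ∈ flowerVerts P := by
  obtain ⟨p, hp, he⟩ := Finset.mem_biUnion.1 he
  exact Finset.mem_biUnion.2 ⟨p, hp, mem_petalVerts_of_mem he hw⟩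

/-- Adding a flower that meets the witness only in the center. -/
lemma Witness.exponent_add_flower_le {x : ℝ} (hx : 0 ≤ x) (hℓ : 3 ≤ ℓ) {J : Witness W}
    (hJ : ∀ e ∈ J.edges, ∀ w ∈ e, w ∈ J.verts) {v : W} (hv : v ∈ J.verts)
    {P : Finset (ZMod ℓ → W)} (hP : IsFlower v P)
    (hdisj : ∀ p ∈ P, ∀ z, p z ∈ J.verts → z = 0) :
    (J.add (flowerVerts P) (flowerEdges P)).exponent x r ≤
      J.exponent x r + P.card * (ℓ * (1 - x) - 1) := by
  have hV : (flowerVerts P \ J.verts).card ≤ P.card * (ℓ - 1) := by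
    have : flowerVerts P \ J.verts ⊆ P.biUnion fun p => (petalVerts p).erase v := by
      intro w hw
      obtain ⟨hw, hwJ⟩ := Finset.mem_sdiff.1 hw
      obtain ⟨p, hp, hw⟩ := Finset.mem_biUnion.1 hw
      exact Finset.mem_biUnion.2 ⟨p, hp, Finset.mem_erase.2 ⟨fun h => hwJ (h ▸ hv), hw⟩⟩
    refine (Finset.card_le_card this).trans (Finset.card_biUnion_le_card_mul _ _ _ fun p hp => ?_)
    rw [Finset.card_erase_of_mem (mem_petalVerts.2 ⟨0, hP.center p hp⟩),
      card_petalVerts (hP.inj p hp)]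
  have hE : (flowerEdges P \ J.edges).card = P.card * ℓ := by
    rw [Finset.sdiff_eq_self_of_disjoint, flowerEdges, Finset.card_biUnion,
      Finset.sum_congr rfl fun p hp => card_petalEdges hℓ (hP.inj p hp), Finset.sum_const,
      smul_eq_mul]
    · intro p hp q hq hpq
      exact Finset.disjoint_left.2 fun e he => hP.not_mem_petalEdges hℓ hp hq hpq he
    · refine Finset.disjoint_left.2 fun e he heJ => ?_
      obtain ⟨p, hp, he⟩ := Finset.mem_biUnion.1 he
      obtain ⟨z, rfl⟩ := mem_petalEdges.1 he
      have h1 := hdisj p hp z (hJ _ heJ _ (Sym2.mem_mk_left _ _))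
      have h2 := hdisj p hp (z + 1) (hJ _ heJ _ (Sym2.mem_mk_right _ _))
      rw [h1, zero_add] at h2
      have : Fact (1 < ℓ) := ⟨by omega⟩
      exact one_ne_zero h2
  have := Witness.exponent_add_le (r := r) hx J hV hE.ge
  have h1 : ((ℓ - 1 : ℕ) : ℝ) = (ℓ : ℝ) - 1 := by
    rw [Nat.cast_sub (by omega), Nat.cast_one]
  push_cast at this
  rw [h1] at this
  linarith

variable {G : Finset (Sym2 W)} {time : Sym2 W → ℕ} {step : Sym2 W → Finset (Sym2 W)}

/-- Given a bound `a` on the number of petals: a witness containing a flower can be extended so that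
the closing steps of all petals are full, and the exponent is then at most as large as in the
tree-like case. -/
def CanComplete (ℓ : ℕ) [NeZero ℓ] (r : ℕ) (x : ℝ) (G : Finset (Sym2 W))
    (step : Sym2 W → Finset (Sym2 W)) (a : ℕ) : Prop :=
  ∀ J : Witness W, J.Valid G → ∀ (v : W) (P : Finset (ZMod ℓ → W)), IsFlower v P → P.card = a →
    flowerEdges P ⊆ J.edges → Disjoint (flowerEdges P) J.full →
    ∃ J' : Witness W, J'.Valid G ∧ J.Extends step (flowerEdges P) J' ∧
      J'.exponent x r ≤ J.exponent x r +
        (treeExponent ℓ r (1 - x) a - 1 - a * (ℓ * (1 - x) - 1)) ∧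
      J'.verts.card ≤ J.verts.card + growth ℓ r a

/-- Extending a witness by an edge `e` that was not selected and closes a petal of a flower.
If that flower overlaps with the witness then one or two of its petals are already as expensive as
the whole tree-like extension; otherwise the flower is added and its closing steps are completed. -/
lemma exists_extends_of_through {x : ℝ} (hx : 0 ≤ x) (hx1 : x ≤ 1) (hℓ : 3 ≤ ℓ) {a : ℕ}
    (hA : 0 ≤ treeExponent ℓ r (1 - x) a) (hA' : ℓ * (1 - x) ≤ 1 + treeExponent ℓ r (1 - x) a)
    (hC : CanComplete ℓ r x G step a) {J : Witness W} (hJ : J.Valid G) {H : Finset (Sym2 W)}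
    (hH : H ⊆ G) {e : Sym2 W} (he : e ∉ G) (hT : Through ℓ (a + 1) H e) :
    ∃ J' : Witness W, J'.Valid G ∧ J.Extends step ∅ J' ∧ (∀ w ∈ e, w ∈ J'.verts) ∧
      J'.exponent x r ≤ J.exponent x r +
        (treeExponent ℓ r (1 - x) a + ((ℓ : ℝ) - 1) * (1 - x)) ∧
      J'.verts.card ≤ J.verts.card + ((a + 1) * ℓ + growth ℓ r a) := by
  obtain ⟨v, P, hP, hPc, hPH, Z, hZ, heZ⟩ := hT
  have hl : ((ℓ - 1 : ℕ) : ℝ) = (ℓ : ℝ) - 1 := by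
    rw [Nat.cast_sub (by omega), Nat.cast_one]
  have heJ : e ∉ J.edges := fun h => he (hJ.edges_sub h)
  have hZi := hP.inj Z hZ
  have hZG : (petalEdges Z).erase e ⊆ G := fun f hf => by
    obtain ⟨hfe, hf⟩ := Finset.mem_erase.1 hf
    exact hH ((Finset.mem_insert.1 (hPH Z hZ hf)).resolve_left hfe)
  have hZV : ∀ f ∈ (petalEdges Z).erase e, ∀ w ∈ f, w ∈ petalVerts Z := fun f hf w hw =>
    mem_petalVerts_of_mem (Finset.mem_of_mem_erase hf) hw
  have heV : ∀ w ∈ e, w ∈ petalVerts Z := fun w hw => mem_petalVerts_of_mem heZ hw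
  have hQG : ∀ p ∈ P, p ≠ Z → petalEdges p ⊆ G := fun p hp hpZ f hf => by
    rcases Finset.mem_insert.1 (hPH p hp hf) with rfl | h
    · exact absurd hf (hP.not_mem_petalEdges hℓ hZ hp hpZ.symm heZ)
    · exact hH h
  set J₁ := J.add (petalVerts Z) ((petalEdges Z).erase e) with hJ₁
  have hJ₁v : J₁.Valid G := hJ.add hZG hZV
  have hJ₁c : J₁.verts.card ≤ J.verts.card + ℓ :=
    (J.card_verts_add_le _ _).trans (by rw [card_petalVerts hZi])
  by_cases hmeet : ∃ z, Z z ∈ J.verts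
  · -- `Z` meets the witness
    refine ⟨J₁, hJ₁v, J.extends_add _ _ _ _, fun w hw => Finset.mem_union_right _ (heV w hw), ?_,
      hJ₁c.trans (by nlinarith [Nat.zero_le (a * ℓ), Nat.zero_le (growth ℓ r a)])⟩
    have h1 := card_petalVerts_sdiff_lt hℓ hZi hJ.mem_verts hmeet heZ heJ
    have h2 : ((petalEdges Z).erase e \ J.edges).card + 1 = (petalEdges Z \ J.edges).card := by
      rw [Finset.erase_sdiff_comm, Finset.card_erase_add_one]
      exact Finset.mem_sdiff.2 ⟨heZ, heJ⟩
    have h3 := J.exponent_add_le (r := r) hx (V := petalVerts Z) (D := (petalEdges Z).erase e)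
      le_rfl (show (petalVerts Z \ J.verts).card ≤ _ by omega)
    have h4 : (petalVerts Z \ J.verts).card ≤ ℓ - 1 := by
      obtain ⟨z, hz⟩ := hmeet
      have : petalVerts Z \ J.verts ⊆ (petalVerts Z).erase (Z z) := fun w hw => by
        obtain ⟨hw, hwJ⟩ := Finset.mem_sdiff.1 hw
        exact Finset.mem_erase.2 ⟨fun h => hwJ (h ▸ hz), hw⟩
      have := Finset.card_le_card this
      rwa [Finset.card_erase_of_mem (mem_petalVerts.2 ⟨z, rfl⟩), card_petalVerts hZi] at this
    have h5 : ((petalVerts Z \ J.verts).card : ℝ) ≤ (ℓ : ℝ) - 1 := by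
      rw [← hl]; exact_mod_cast h4
    have h6 := mul_le_mul_of_nonneg_right h5 (sub_nonneg.2 hx1)
    linarith
  push Not at hmeet
  have hJ₁e : J₁.exponent x r ≤ J.exponent x r + (1 + ((ℓ : ℝ) - 1) * (1 - x)) := by
    have h2 : ((petalEdges Z).erase e \ J.edges).card = ℓ - 1 := by
      rw [Finset.sdiff_eq_self_of_disjoint, Finset.card_erase_of_mem heZ, card_petalEdges hℓ hZi]
      refine Finset.disjoint_left.2 fun f hf hfJ => ?_
      obtain ⟨z, rfl⟩ := mem_petalEdges.1 (Finset.mem_of_mem_erase hf)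
      exact hmeet z (hJ.mem_verts _ hfJ _ (Sym2.mem_mk_left _ _))
    have h3 := J.exponent_add_le (r := r) hx (V := petalVerts Z) (D := (petalEdges Z).erase e)
      (a := ℓ) ((Finset.card_le_card Finset.sdiff_subset).trans (card_petalVerts hZi).le) h2.ge
    rw [hl] at h3
    linarith
  have hvZ : v ∈ petalVerts Z := mem_petalVerts.2 ⟨0, hP.center Z hZ⟩
  have hvJ : v ∉ J.verts := hP.center Z hZ ▸ hmeet 0
  by_cases hmeet' : ∃ p ∈ P, p ≠ Z ∧ ∃ z, p z ∈ J.verts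
  · -- `Z` does not meet the witness, but another petal `p` does
    obtain ⟨p, hp, hpZ, z, hz⟩ := hmeet'
    have hpi := hP.inj p hp
    have ha : 1 ≤ a := by
      have := Finset.card_le_card (Finset.insert_subset hp (Finset.singleton_subset_iff.2 hZ))
      rw [Finset.card_pair hpZ, hPc] at this
      omega
    refine ⟨J₁.add (petalVerts p) (petalEdges p),
      hJ₁v.add (hQG p hp hpZ) (fun f hf w hw => mem_petalVerts_of_mem hf hw),
      (J.extends_add step ∅ _ _).trans (J₁.extends_add step ∅ _ _) subset_rfl (by simp),
      fun w hw => Finset.mem_union_left _ (Finset.mem_union_right _ (heV w hw)), ?_,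
      (J₁.card_verts_add_le _ _).trans ?_⟩
    · set Y : Finset (ZMod ℓ) := Finset.univ.filter fun i => p i ∉ J.verts with hY
      have h0Y : (0 : ZMod ℓ) ∈ Y := by simp [hY, hP.center p hp, hvJ]
      have hYu : Y ≠ Finset.univ := fun h => by
        have : z ∈ Y := h ▸ Finset.mem_univ z
        simp [hY, hz] at this
      have h1 : Y.card + 1 ≤ (petalEdges p \ J₁.edges).card := by
        refine card_add_one_le_card_petalEdges_sdiff hℓ hpi ⟨0, h0Y⟩ hYu ?_
        intro f hf i hi hfi hfJ
        rcases Finset.mem_union.1 hfJ with h | h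
        · simp only [hY, Finset.mem_filter] at hi
          exact hi.2 (hJ.mem_verts f h _ hfi)
        · exact hP.not_mem_petalEdges hℓ hp hZ hpZ hf (Finset.mem_of_mem_erase h)
      have h2 : (petalVerts p \ J₁.verts).card ≤ Y.card - 1 := by
        rw [← Finset.card_erase_of_mem h0Y, ← Finset.card_image_of_injective _ hpi]
        refine Finset.card_le_card fun w hw => ?_
        obtain ⟨hw, hwJ⟩ := Finset.mem_sdiff.1 hw
        obtain ⟨i, rfl⟩ := mem_petalVerts.1 hw
        simp only [hJ₁, Witness.add, Finset.mem_union, not_or] at hwJ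
        refine Finset.mem_image_of_mem _ (Finset.mem_erase.2 ⟨?_, by simp [hY, hwJ.1]⟩)
        rintro rfl
        exact hwJ.2 (hP.center p hp ▸ hvZ)
      have h3 := J₁.exponent_add_le (r := r) hx (V := petalVerts p) (D := petalEdges p) h2 h1
      have h4 : 1 ≤ Y.card := Finset.card_pos.2 ⟨0, h0Y⟩
      have h5 : Y.card ≤ ℓ - 1 := by
        have := Finset.card_lt_univ_of_notMem (s := Y) (x := z) (by simp [hY, hz])
        rw [ZMod.card] at this
        omega
      have h6 : (Y.card : ℝ) ≤ (ℓ : ℝ) - 1 := by rw [← hl]; exact_mod_cast h5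
      have h7 := mul_le_mul_of_nonneg_right h6 (sub_nonneg.2 hx1)
      rw [Nat.cast_sub h4] at h3
      push_cast at h3
      linarith
    · rw [card_petalVerts hpi]
      nlinarith [Nat.zero_le (growth ℓ r a), Nat.mul_le_mul_right ℓ ha]
  push Not at hmeet'
  -- the flower does not meet the witness
  set Q := P.erase Z with hQ
  have hQc : Q.card = a := by rw [hQ, Finset.card_erase_of_mem hZ, hPc]; rfl
  have hQP : Q ⊆ P := Finset.erase_subset _ _
  have hQf := hP.mono hQP
  have hQ' : ∀ p ∈ Q, p ∈ P ∧ p ≠ Z := fun p hp =>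
    ⟨Finset.mem_of_mem_erase hp, Finset.ne_of_mem_erase hp⟩
  set J₂ := J₁.add (flowerVerts Q) (flowerEdges Q) with hJ₂
  have hJ₂v : J₂.Valid G := by
    refine hJ₁v.add ?_ (fun f hf w hw => mem_flowerVerts_of_mem hf hw)
    exact Finset.biUnion_subset.2 fun p hp => hQG p (hQ' p hp).1 (hQ' p hp).2
  have hQJ : ∀ f ∈ flowerEdges Q, f ∉ J.edges := by
    intro f hf hfJ
    obtain ⟨p, hp, hf⟩ := Finset.mem_biUnion.1 hf
    obtain ⟨z, rfl⟩ := mem_petalEdges.1 hf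
    exact hmeet' p (hQ' p hp).1 (hQ' p hp).2 z (hJ.mem_verts _ hfJ _ (Sym2.mem_mk_left _ _))
  have hJ₂e : J₂.exponent x r ≤ J₁.exponent x r + Q.card * (ℓ * (1 - x) - 1) := by
    refine Witness.exponent_add_flower_le hx hℓ hJ₁v.mem_verts (Finset.mem_union_right _ hvZ)
      hQf ?_
    intro p hp i hi
    rcases Finset.mem_union.1 hi with h | h
    · exact absurd h (hmeet' p (hQ' p hp).1 (hQ' p hp).2 i)
    · obtain ⟨j, hj⟩ := mem_petalVerts.1 h
      exact hP.disj p (hQ' p hp).1 Z hZ (hQ' p hp).2 i j hj.symm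
  obtain ⟨J₃, hJ₃v, hJ₃x, hJ₃e, hJ₃c⟩ := hC J₂ hJ₂v v Q hQf hQc Finset.subset_union_right
    (Finset.disjoint_left.2 fun f hf hfJ => hQJ f hf (hJ.full_sub hfJ))
  have hJJ₂ : J.Extends step ∅ J₂ :=
    (J.extends_add step ∅ _ _).trans (J₁.extends_add step ∅ _ _) subset_rfl (by simp)
  refine ⟨J₃, hJ₃v, hJJ₂.trans hJ₃x subset_rfl (fun f hf => Or.inr (hQJ f hf)), fun w hw =>
    hJ₃x.verts (Finset.mem_union_left _ (Finset.mem_union_right _ (heV w hw))), ?_, ?_⟩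
  · rw [hQc] at hJ₂e
    linarith
  · have h1 : J₂.verts.card ≤ _ := J₁.card_verts_add_le (flowerVerts Q) (flowerEdges Q)
    have h2 := card_flowerVerts_le Q
    rw [hQc] at h2
    have : (a + 1) * ℓ = a * ℓ + ℓ := by ring
    omega

/-- Completing the closing step of a cycle. -/
lemma exists_extends_full {x : ℝ} (hx : 0 ≤ x) (hx1 : x ≤ 1) (hℓ : 3 ≤ ℓ) {a : ℕ}
    (hA : 0 ≤ treeExponent ℓ r (1 - x) a) (hA' : ℓ * (1 - x) ≤ 1 + treeExponent ℓ r (1 - x) a)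
    (hrun : IsGreedyRun ℓ r G time step)
    (hC : CanComplete ℓ r x G step a) {J : Witness W} (hJ : J.Valid G) {e : Sym2 W}
    (he : e ∈ J.edges) (hef : e ∉ J.full)
    (hT : Through ℓ (a + 1) (G.filter fun f => time f < time e) e) :
    ∃ J' : Witness W, J'.Valid G ∧ J.Extends step {e} J' ∧
      J'.exponent x r ≤ J.exponent x r +
        ((r : ℝ) - 1) * (treeExponent ℓ r (1 - x) a + ((ℓ : ℝ) - 1) * (1 - x) - 2) ∧
      J'.verts.card ≤ J.verts.card + r * ((a + 1) * ℓ + growth ℓ r a) := by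
  have heG := hJ.edges_sub he
  set J₀ : Witness W := ⟨J.verts, J.edges, insert e J.full⟩ with hJ₀
  have hJ₀v : J₀.Valid G := ⟨hJ.edges_sub, Finset.insert_subset he hJ.full_sub, hJ.mem_verts⟩
  have hJ₀e : J₀.exponent x r = J.exponent x r - 2 * ((r : ℝ) - 1) := by
    simp only [Witness.exponent, hJ₀]
    rw [Finset.card_insert_of_notMem hef]
    push_cast
    ring
  have hunsel : ∀ f ∈ (step e).erase e, f ∉ G := by
    intro f hf hfG
    obtain ⟨hfe, hf⟩ := Finset.mem_erase.1 hf
    exact Finset.disjoint_left.1 (hrun.disjoint f hfG e heG hfe) (hrun.mem_step f hfG) hf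
  have key : ∀ T ⊆ (step e).erase e, ∃ J' : Witness W, J'.Valid G ∧ J₀.Extends step ∅ J' ∧
      (∀ f ∈ T, ∀ w ∈ f, w ∈ J'.verts) ∧
      J'.exponent x r ≤ J₀.exponent x r +
        T.card * (treeExponent ℓ r (1 - x) a + ((ℓ : ℝ) - 1) * (1 - x)) ∧
      J'.verts.card ≤ J₀.verts.card + T.card * ((a + 1) * ℓ + growth ℓ r a) := by
    intro T
    induction T using Finset.induction_on with
    | empty =>
      intro _
      exact ⟨J₀, hJ₀v, Witness.Extends.refl _ _ _, by simp, by simp, by simp⟩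
    | insert f T hfT ih =>
      intro hT'
      obtain ⟨hf, hT'⟩ := Finset.insert_subset_iff.1 hT'
      obtain ⟨J₁, hv, hext, hcov, hexp, hcard⟩ := ih hT'
      obtain ⟨J₂, hv', hext', hcov', hexp', hcard'⟩ := exists_extends_of_through hx hx1 hℓ hA hA' hC
        hv (Finset.filter_subset _ _) (hunsel f hf)
        (hrun.greedy e heG _ hT f (Finset.mem_of_mem_erase hf))
      refine ⟨J₂, hv', hext.trans hext' subset_rfl (by simp), ?_, ?_, ?_⟩
      · intro g hg w hw
        rcases Finset.mem_insert.1 hg with rfl | hg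
        · exact hcov' w hw
        · exact hext'.verts (hcov g hg w hw)
      · rw [Finset.card_insert_of_notMem hfT]
        push_cast
        linarith
      · rw [Finset.card_insert_of_notMem hfT, add_mul]
        omega
  obtain ⟨J', hv, hext, hcov, hexp, hcard⟩ := key _ subset_rfl
  have hr : 1 ≤ r := by
    rw [← hrun.card_step e heG]
    exact Finset.card_pos.2 ⟨e, hrun.mem_step e heG⟩
  rw [Finset.card_erase_of_mem (hrun.mem_step e heG), hrun.card_step e heG] at hexp hcard
  refine ⟨J', hv, ⟨hext.verts, hext.edges, (Finset.subset_insert _ _).trans hext.full, ?_, ?_⟩,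
    ?_, ?_⟩
  · intro f hf hfJ
    by_cases hfe : f = e
    · exact Or.inl (Finset.mem_singleton.2 hfe)
    · exact (hext.new_full f hf (by simp [hJ₀, hfe, hfJ])).imp_left (by simp)
  · intro f hf hfJ g hg w hw
    by_cases hfe : f = e
    · subst hfe
      by_cases hgf : g = f
      · subst hgf
        exact hext.verts (hJ.mem_verts g he w hw)
      · exact hcov g (Finset.mem_erase.2 ⟨hgf, hg⟩) w hw
    · exact hext.covered f hf (by simp [hJ₀, hfe, hfJ]) g hg w hw
  · rw [hJ₀e, Nat.cast_sub hr] at hexp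
    push_cast at hexp
    linarith
  · refine hcard.trans (Nat.add_le_add_left (Nat.mul_le_mul_right _ (Nat.sub_le _ _)) _)

/-- The petals of a flower are completed in the order in which they are closed: the `b`-th of them
is closed by an edge that creates a flower with `b` petals. -/
lemma canComplete {x : ℝ} (hx : 0 ≤ x) (hx1 : x ≤ 1) (hℓ : 3 ≤ ℓ) {k : ℕ}
    (hA : ∀ a < k, 0 ≤ treeExponent ℓ r (1 - x) a ∧
      ℓ * (1 - x) ≤ 1 + treeExponent ℓ r (1 - x) a)
    (hrun : IsGreedyRun ℓ r G time step) {a : ℕ} (ha : a ≤ k) : CanComplete ℓ r x G step a := by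
  induction a with
  | zero =>
    intro J hJ v P hP hPc hPJ hPf
    exact ⟨J, hJ, Witness.Extends.refl _ _ _, by simp [treeExponent], by simp⟩
  | succ a ih =>
    have hC := ih (by omega)
    intro J hJ v P hP hPc hPJ hPf
    have hne : (flowerEdges P).Nonempty := by
      obtain ⟨p, hp⟩ := Finset.card_pos.1 (show 0 < P.card by omega)
      exact ⟨petalEdge p 0, Finset.mem_biUnion.2 ⟨p, hp, mem_petalEdges.2 ⟨0, rfl⟩⟩⟩
    obtain ⟨e, he, hmax⟩ := Finset.exists_max_image _ time hne
    obtain ⟨p, hp, hep⟩ := Finset.mem_biUnion.1 he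
    set Q := P.erase p with hQ
    have hQP : flowerEdges Q ⊆ flowerEdges P :=
      Finset.biUnion_subset_biUnion_of_subset_left _ (Finset.erase_subset _ _)
    obtain ⟨J₁, hv, hext, hexp, hcard⟩ := hC J hJ v Q (hP.mono (Finset.erase_subset _ _))
      (by rw [hQ, Finset.card_erase_of_mem hp, hPc]; rfl) (hQP.trans hPJ)
      (hPf.mono_left hQP)
    have heQ : e ∉ flowerEdges Q := by
      intro h
      obtain ⟨q, hq, heq⟩ := Finset.mem_biUnion.1 h
      exact hP.not_mem_petalEdges hℓ hp (Finset.mem_of_mem_erase hq)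
        (Finset.ne_of_mem_erase hq).symm hep heq
    have heJ₁ : e ∉ J₁.full := fun h =>
      (hext.new_full e h (Finset.disjoint_left.1 hPf he)).elim heQ (fun h' => h' (hPJ he))
    have hT : Through ℓ (a + 1) (G.filter fun f => time f < time e) e := by
      refine ⟨v, P, hP, hPc, fun q hq f hf => ?_, p, hp, hep⟩
      have hfP : f ∈ flowerEdges P := Finset.mem_biUnion.2 ⟨q, hq, hf⟩
      have hfG := hJ.edges_sub (hPJ hfP)
      rcases (hmax f hfP).lt_or_eq with h | h
      · exact Finset.mem_insert_of_mem (Finset.mem_filter.2 ⟨hfG, h⟩)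
      · rw [hrun.time_inj f hfG e (hJ.edges_sub (hPJ he)) h]
        exact Finset.mem_insert_self _ _
    obtain ⟨J₂, hv', hext', hexp', hcard'⟩ := exists_extends_full hx hx1 hℓ (hA a (by omega)).1
      (hA a (by omega)).2 hrun hC hv (hext.edges (hPJ he)) heJ₁ hT
    refine ⟨J₂, hv', hext.trans hext' hQP ?_, ?_, ?_⟩
    · intro f hf
      rw [Finset.mem_singleton.1 hf]
      exact Or.inl he
    · simp only [treeExponent]
      push_cast
      linarith
    · simp only [growth]
      omega

/-- If the selected edges contain a flower with `k` petals then they contain a witness of bounded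
size whose exponent is at most that of the tree-like witness. -/
lemma exists_witness {x : ℝ} (hx : 0 ≤ x) (hx1 : x ≤ 1) (hℓ : 3 ≤ ℓ) {k : ℕ} (hk : 1 ≤ k)
    (hA : ∀ a < k, 0 ≤ treeExponent ℓ r (1 - x) a ∧
      ℓ * (1 - x) ≤ 1 + treeExponent ℓ r (1 - x) a)
    (hrun : IsGreedyRun ℓ r G time step) {v : W} {P : Finset (ZMod ℓ → W)} (hP : IsFlower v P)
    (hPc : P.card = k) (hPG : flowerEdges P ⊆ G) :
    ∃ J : Witness W, J.Valid G ∧ J.edges.Nonempty ∧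
      (∀ f ∈ J.full, ∀ e ∈ step f, ∀ w ∈ e, w ∈ J.verts) ∧
      J.exponent x r ≤ treeExponent ℓ r (1 - x) k ∧
      J.verts.card ≤ 1 + k * ℓ + growth ℓ r k := by
  set J₀ : Witness W := ⟨{v}, ∅, ∅⟩ with hJ₀
  have hJ₀v : J₀.Valid G := ⟨by simp [hJ₀], by simp [hJ₀], by simp [hJ₀]⟩
  have hexp₀ : J₀.exponent x r = 1 := by simp [Witness.exponent, hJ₀]
  set J₁ := J₀.add (flowerVerts P) (flowerEdges P) with hJ₁
  have hJ₁v : J₁.Valid G := hJ₀v.add hPG fun f hf w hw => mem_flowerVerts_of_mem hf hw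
  have hexp₁ : J₁.exponent x r ≤ J₀.exponent x r + P.card * (ℓ * (1 - x) - 1) := by
    refine Witness.exponent_add_flower_le hx hℓ hJ₀v.mem_verts (v := v) (by simp [hJ₀]) hP ?_
    intro p hp z hz
    apply hP.inj p hp
    rw [hP.center p hp]
    simpa [hJ₀] using hz
  obtain ⟨J₂, hv, hext, hexp, hcard⟩ := canComplete hx hx1 hℓ hA hrun le_rfl J₁ hJ₁v v P hP hPc
    Finset.subset_union_right (by simp [hJ₁, hJ₀, Witness.add])
  refine ⟨J₂, hv, ?_, ?_, ?_, ?_⟩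
  · obtain ⟨p, hp⟩ := Finset.card_pos.1 (show 0 < P.card by omega)
    exact ⟨petalEdge p 0, hext.edges (Finset.mem_union_right _
      (Finset.mem_biUnion.2 ⟨p, hp, mem_petalEdges.2 ⟨0, rfl⟩⟩))⟩
  · exact fun f hf => hext.covered f hf (by simp [hJ₁, hJ₀, Witness.add])
  · rw [hPc] at hexp₁
    linarith
  · have h1 : J₁.verts.card ≤ _ := J₀.card_verts_add_le (flowerVerts P) (flowerEdges P)
    have h2 := card_flowerVerts_le P
    have h3 : J₀.verts.card = 1 := by simp [hJ₀]
    rw [hPc] at h2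
    omega

end Witness

/-! ### The probability that prescribed edges are revealed -/

section Probability

variable {n r : ℕ}

/-- The set revealed in the `i`-th step, where steps are numbered from `0`; it is empty if there was
no such step. -/
def revealedAt : History n → ℕ → Finset (Sym2 (Fin n))
  | [], _ => ∅
  | S :: h, i => if i = h.length then S else revealedAt h i

/-- In each step, `r` edges not seen before were revealed. -/
def IsValid (r : ℕ) : History n → Prop
  | [] => True
  | S :: h => S ∈ offers n r h ∧ IsValid r h

lemma revealedAt_of_length_le : ∀ (h : History n) {i : ℕ}, h.length ≤ i → revealedAt h i = ∅
  | [], _, _ => rfl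
  | S :: h, i, hi => by
    rw [List.length_cons] at hi
    rw [revealedAt, if_neg (by omega), revealedAt_of_length_le h (by omega)]

lemma card_unseen (h : History n) (hv : IsValid r h) :
    n.choose 2 ≤ ((⊤ : SimpleGraph (Fin n)).edgeFinset.filter fun e => ∀ S ∈ h, e ∉ S).card +
      r * h.length := by
  induction h with
  | nil =>
    rw [Finset.filter_true_of_mem (by simp), SimpleGraph.card_edgeFinset_top_eq_card_choose_two,
      Fintype.card_fin]
    exact Nat.le_add_right _ _
  | cons S h ih =>
    obtain ⟨hS, hv⟩ := hv
    have hSc := (Finset.mem_powersetCard.1 hS).2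
    have heq : ((⊤ : SimpleGraph (Fin n)).edgeFinset.filter fun e => ∀ T ∈ S :: h, e ∉ T) =
        ((⊤ : SimpleGraph (Fin n)).edgeFinset.filter fun e => ∀ T ∈ h, e ∉ T) \ S := by
      ext e
      simp only [Finset.mem_filter, List.forall_mem_cons, Finset.mem_sdiff]
      tauto
    have h1 := Finset.le_card_sdiff S
      ((⊤ : SimpleGraph (Fin n)).edgeFinset.filter fun e => ∀ T ∈ h, e ∉ T)
    have h2 := ih hv
    rw [heq, List.length_cons, Nat.mul_succ]
    omega

lemma card_offers (h : History n) : (offers n r h).card =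
    ((⊤ : SimpleGraph (Fin n)).edgeFinset.filter fun e => ∀ S ∈ h, e ∉ S).card.choose r :=
  Finset.card_powersetCard _ _

/-- As long as enough edges remain, all steps are played. -/
lemma isValid_of_mem_support {N : ℕ} (hN : r * N ≤ n.choose 2) {h : History n}
    (hh : h ∈ (historyLaw n r N).support) : IsValid r h ∧ h.length = N := by
  induction N generalizing h with
  | zero =>
    simp only [historyLaw, PMF.support_pure, Set.mem_singleton_iff] at hh
    subst hh
    exact ⟨trivial, rfl⟩
  | succ N ih =>
    rw [historyLaw, PMF.mem_support_bind_iff] at hh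
    obtain ⟨h', hh', hh⟩ := hh
    rw [Nat.mul_succ] at hN
    obtain ⟨hv, hl⟩ := ih (by omega) hh'
    have hne : (offers n r h').Nonempty := by
      rw [← Finset.card_pos, card_offers]
      have := card_unseen h' hv
      rw [hl] at this
      exact Nat.choose_pos (by omega)
    rw [dif_pos hne, PMF.mem_support_map_iff] at hh
    obtain ⟨S, hS, rfl⟩ := hh
    rw [PMF.mem_support_uniformOfFinset_iff] at hS
    exact ⟨⟨hS, hv⟩, by rw [List.length_cons, hl]⟩

lemma choose_sub_mul_pow_le {M r t : ℕ} (hr : r ≤ M) (ht : t ≤ r) :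
    (M - t).choose (r - t) * M ^ t ≤ r ^ t * M.choose r := by
  induction t with
  | zero => simp
  | succ t ih =>
    have h := ih (by omega)
    obtain ⟨a, rfl⟩ : ∃ a, r = t + 1 + a := ⟨r - (t + 1), by omega⟩
    obtain ⟨b, rfl⟩ : ∃ b, M = t + 1 + a + b := ⟨M - (t + 1 + a), by omega⟩
    have e1 : t + 1 + a + b - t = a + b + 1 := by omega
    have e2 : t + 1 + a - t = a + 1 := by omega
    have e3 : t + 1 + a + b - (t + 1) = a + b := by omega
    have e4 : t + 1 + a - (t + 1) = a := by omega
    rw [e1, e2] at h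
    rw [e3, e4]
    have hc := Nat.add_one_mul_choose_eq (a + b) a
    have hM : (a + 1) * (t + 1 + a + b) ≤ (t + 1 + a) * (a + b + 1) := by nlinarith
    refine Nat.le_of_mul_le_mul_left ?_ (show 0 < a + b + 1 by omega)
    calc (a + b + 1) * ((a + b).choose a * (t + 1 + a + b) ^ (t + 1))
        = ((a + b + 1) * (a + b).choose a) * (t + 1 + a + b) ^ (t + 1) := by ring
      _ = (a + b + 1).choose (a + 1) * (t + 1 + a + b) ^ t * ((a + 1) * (t + 1 + a + b)) := by
        rw [hc]; ring
      _ ≤ ((t + 1 + a) ^ t * (t + 1 + a + b).choose (t + 1 + a)) *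
          ((t + 1 + a) * (a + b + 1)) := Nat.mul_le_mul h hM
      _ = _ := by ring

lemma card_filter_subset_powersetCard {α : Type*} [DecidableEq α] (A T : Finset α) {K : ℕ}
    (hK : K ≤ A.card) (hr : r ≤ A.card) :
    ((A.powersetCard r).filter fun S => T ⊆ S).card * K ^ T.card ≤
      r ^ T.card * (A.powersetCard r).card := by
  rcases ((A.powersetCard r).filter fun S => T ⊆ S).eq_empty_or_nonempty with h0 | ⟨S₀, hS₀⟩
  · rw [h0]; simp
  obtain ⟨hS₀, hTS₀⟩ := Finset.mem_filter.1 hS₀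
  obtain ⟨hSA, hSc⟩ := Finset.mem_powersetCard.1 hS₀
  have htr : T.card ≤ r := hSc ▸ Finset.card_le_card hTS₀
  have hTA := hTS₀.trans hSA
  have h1 : ((A.powersetCard r).filter fun S => T ⊆ S).card ≤
      ((A \ T).powersetCard (r - T.card)).card := by
    refine Finset.card_le_card_of_injOn (fun S => S \ T) ?_ ?_
    · intro S hS
      obtain ⟨hS, hTS⟩ := Finset.mem_filter.1 hS
      obtain ⟨hSA, hSc⟩ := Finset.mem_powersetCard.1 hS
      exact Finset.mem_powersetCard.2 ⟨Finset.sdiff_subset_sdiff hSA subset_rfl, by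
        rw [Finset.card_sdiff_of_subset hTS, hSc]⟩
    · intro S hS S' hS' hSS'
      have h1 := Finset.sdiff_union_of_subset (Finset.mem_filter.1 hS).2
      have h2 := Finset.sdiff_union_of_subset (Finset.mem_filter.1 hS').2
      simp only at hSS'
      rw [← h1, ← h2, hSS']
  rw [Finset.card_powersetCard, Finset.card_sdiff_of_subset hTA] at h1
  rw [Finset.card_powersetCard]
  exact (Nat.mul_le_mul h1 (Nat.pow_le_pow_left hK _)).trans (choose_sub_mul_pow_le hr htr)

lemma toOuterMeasure_le_one {α : Type*} (p : PMF α) (s : Set α) : p.toOuterMeasure s ≤ 1 :=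
  (MeasureTheory.measure_mono (Set.subset_univ s)).trans
    ((PMF.toOuterMeasure_apply_eq_one_iff p _).2 (Set.subset_univ _)).le

lemma natCast_div_le_div_pow {a c K t : ℕ} (hK : 0 < K)
    (h : a * K ^ t ≤ r ^ t * c) : (a : ℝ≥0∞) / c ≤ ((r : ℝ≥0∞) / K) ^ t := by
  have hK0 : ((K : ℝ≥0∞) ^ t) ≠ 0 := pow_ne_zero _ (by exact_mod_cast hK.ne')
  have hKt : ((K : ℝ≥0∞) ^ t) ≠ ∞ := ENNReal.pow_ne_top (ENNReal.natCast_ne_top K)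
  refine ENNReal.div_le_of_le_mul ?_
  rw [div_eq_mul_inv (r : ℝ≥0∞), mul_pow, ← ENNReal.inv_pow, ← div_eq_mul_inv,
    ← ENNReal.mul_div_right_comm, ENNReal.le_div_iff_mul_le (Or.inl hK0) (Or.inl hKt)]
  exact_mod_cast h

/-- The probability that prescribed edges are revealed in prescribed steps. -/
lemma historyLaw_forall_mem_le {K : ℕ} (hK : 0 < K) {N : ℕ} (hN : r * N + K ≤ n.choose 2)
    (P : Finset (Sym2 (Fin n) × ℕ)) :
    (historyLaw n r N).toOuterMeasure {h | ∀ q ∈ P, q.1 ∈ revealedAt h q.2} ≤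
      ((r : ℝ≥0∞) / K) ^ P.card := by
  classical
  induction N generalizing P with
  | zero =>
    rcases P.eq_empty_or_nonempty with rfl | ⟨q, hq⟩
    · simpa using toOuterMeasure_le_one _ _
    · have : {h : History n | ∀ q ∈ P, q.1 ∈ revealedAt h q.2} ∩
          (historyLaw n r 0).support = ∅ := by
        ext h
        simp only [historyLaw, PMF.support_pure, Set.mem_inter_iff, Set.mem_ofPred_eq,
          Set.mem_singleton_iff, Set.mem_empty_iff_false, iff_false, not_and]
        rintro hP rfl
        simpa [revealedAt] using hP q hq
      rw [← PMF.toOuterMeasure_apply_inter_support, this]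
      simp
  | succ N ih =>
    rw [Nat.mul_succ] at hN
    set P₁ := P.filter fun q => q.2 ≠ N with hP₁
    set P₂ := P.filter fun q => q.2 = N with hP₂
    have hcard : P₁.card + P₂.card = P.card := by
      rw [add_comm]; exact Finset.card_filter_add_card_filter_not _
    set T := P₂.image Prod.fst with hT
    have hTc : T.card = P₂.card := by
      refine Finset.card_image_of_injOn fun a ha b hb hab => ?_
      exact Prod.ext hab
        ((Finset.mem_filter.1 ha).2.trans (Finset.mem_filter.1 hb).2.symm)
    rw [historyLaw, PMF.toOuterMeasure_bind_apply]
    have hstep : ∀ h : History n, historyLaw n r N h * (if hne : (offers n r h).Nonempty then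
        (PMF.uniformOfFinset (offers n r h) hne).map fun S => S :: h
        else PMF.pure h).toOuterMeasure {h | ∀ q ∈ P, q.1 ∈ revealedAt h q.2} ≤
        ({h | ∀ q ∈ P₁, q.1 ∈ revealedAt h q.2} : Set (History n)).indicator
          (historyLaw n r N) h * ((r : ℝ≥0∞) / K) ^ P₂.card := by
      intro h
      by_cases hs : h ∈ (historyLaw n r N).support
      swap
      · rw [PMF.mem_support_iff, not_not] at hs
        rw [hs, zero_mul]
        exact zero_le
      obtain ⟨hv, hl⟩ := isValid_of_mem_support (by omega) hs
      have hun := card_unseen h hv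
      rw [hl] at hun
      have hne : (offers n r h).Nonempty := by
        rw [← Finset.card_pos, card_offers]
        exact Nat.choose_pos (by omega)
      rw [dif_pos hne, PMF.toOuterMeasure_map_apply]
      by_cases hE : ∀ q ∈ P₁, q.1 ∈ revealedAt h q.2
      · rw [Set.indicator_of_mem (show h ∈ {h | ∀ q ∈ P₁, q.1 ∈ revealedAt h q.2} from hE)]
        refine mul_le_mul_right ?_ _
        have hsub : ((fun S => S :: h) ⁻¹' {h : History n | ∀ q ∈ P, q.1 ∈ revealedAt h q.2}) ⊆
            {S | T ⊆ S} := by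
          intro S hS f hf
          obtain ⟨q, hq, rfl⟩ := Finset.mem_image.1 hf
          obtain ⟨hq, hqN⟩ := Finset.mem_filter.1 hq
          have := hS q hq
          rwa [revealedAt, if_pos (hqN.trans hl.symm)] at this
        refine (MeasureTheory.measure_mono hsub).trans ?_
        rw [PMF.toOuterMeasure_uniformOfFinset_apply]
        have hc := card_filter_subset_powersetCard (r := r)
          ((⊤ : SimpleGraph (Fin n)).edgeFinset.filter fun e => ∀ S ∈ h, e ∉ S) T (K := K)
          (by omega) (by omega)
        change ((offers n r h).filter fun S => T ⊆ S).card * _ ≤ _ * (offers n r h).card at hc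
        rw [hTc] at hc
        exact natCast_div_le_div_pow hK (by convert hc; exact Set.mem_ofPred)
      · have : ((fun S => S :: h) ⁻¹' {h : History n | ∀ q ∈ P, q.1 ∈ revealedAt h q.2}) = ∅ := by
          refine Set.eq_empty_of_forall_notMem fun S hS => hE fun q hq => ?_
          obtain ⟨hq, hqN⟩ := Finset.mem_filter.1 hq
          have := hS q hq
          rwa [revealedAt, if_neg (fun h => hqN (h.trans hl))] at this
        rw [this]
        simp
    refine (ENNReal.tsum_le_tsum hstep).trans ?_
    rw [ENNReal.tsum_mul_right, ← PMF.toOuterMeasure_apply, ← hcard, pow_add]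
    exact mul_le_mul_left (ih (by omega) P₁) _

end Probability

/-! ### The greedy strategy -/

section GreedyStrategy

variable {ℓ : ℕ} [NeZero ℓ] {n r : ℕ}

open Classical in
/-- The largest number of petals of a flower through `e` that is created by adding `e` to `H`. -/
noncomputable def flowerRank (ℓ : ℕ) [NeZero ℓ] (H : Finset (Sym2 (Fin n))) (e : Sym2 (Fin n)) :
    ℕ :=
  Nat.findGreatest (fun b => Through ℓ b H e) (Fintype.card (ZMod ℓ → Fin n))

lemma Through.le_flowerRank {H : Finset (Sym2 (Fin n))} {e : Sym2 (Fin n)} {b : ℕ}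
    (h : Through ℓ b H e) : b ≤ flowerRank ℓ H e := by
  classical
  refine Nat.le_findGreatest ?_ h
  obtain ⟨v, P, -, hP, -⟩ := h
  rw [← hP]
  exact Finset.card_le_univ P

lemma Through.one_le {H : Finset (Sym2 (Fin n))} {e : Sym2 (Fin n)} {b : ℕ}
    (h : Through ℓ b H e) : 1 ≤ b := by
  obtain ⟨v, P, -, hP, -, p, hp, -⟩ := h
  rw [← hP]
  exact Finset.card_pos.2 ⟨p, hp⟩

lemma through_of_le_flowerRank {H : Finset (Sym2 (Fin n))} {e : Sym2 (Fin n)} {b : ℕ}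
    (hb : 1 ≤ b) (h : b ≤ flowerRank ℓ H e) : Through ℓ b H e := by
  classical
  have h1 : Through ℓ (flowerRank ℓ H e) H e :=
    Nat.findGreatest_of_ne_zero (P := fun b => Through ℓ b H e) rfl (by omega)
  exact h1.of_le hb h

/-- An edge of minimal rank in `S`. -/
noncomputable def greedyPick (ℓ : ℕ) [NeZero ℓ] (H S : Finset (Sym2 (Fin n))) (hS : S.Nonempty) :
    S :=
  ⟨(Finset.exists_min_image S (flowerRank ℓ H) hS).choose,
    (Finset.exists_min_image S (flowerRank ℓ H) hS).choose_spec.1⟩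

lemma flowerRank_greedyPick_le {H S : Finset (Sym2 (Fin n))} (hS : S.Nonempty) {f : Sym2 (Fin n)}
    (hf : f ∈ S) : flowerRank ℓ H (greedyPick ℓ H S hS) ≤ flowerRank ℓ H f :=
  (Finset.exists_min_image S (flowerRank ℓ H) hS).choose_spec.2 f hf

/-- The edges selected by a player who always selects an edge of minimal rank. -/
noncomputable def greedyChosen (ℓ : ℕ) [NeZero ℓ] : History n → Finset (Sym2 (Fin n))
  | [] => ∅
  | S :: h => if hS : S.Nonempty then
      insert (greedyPick ℓ (greedyChosen ℓ h) S hS : Sym2 (Fin n)) (greedyChosen ℓ h)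
    else greedyChosen ℓ h

/-- The strategy of always selecting an edge of minimal rank. -/
noncomputable def greedyStrategy (ℓ : ℕ) [NeZero ℓ] (n : ℕ) : Strategy n :=
  fun h S hS => greedyPick ℓ (greedyChosen ℓ h) S hS

lemma chosen_greedyStrategy (h : History n) :
    chosen (greedyStrategy ℓ n) h = greedyChosen ℓ h := by
  induction h with
  | nil => rfl
  | cons S h ih => simp only [chosen, greedyChosen, greedyStrategy, ih]

/-- The number of the step in which `e` was revealed. -/
def revealTime : History n → Sym2 (Fin n) → ℕ
  | [], _ => 0
  | S :: h, e => if e ∈ S then h.length else revealTime h e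

lemma revealedAt_subset (h : History n) (i : ℕ) :
    ∀ e ∈ revealedAt h i, ∃ S ∈ h, e ∈ S := by
  induction h with
  | nil => simp [revealedAt]
  | cons S h ih =>
    intro e he
    rw [revealedAt] at he
    split_ifs at he
    · exact ⟨S, by simp, he⟩
    · obtain ⟨T, hT, he⟩ := ih e he
      exact ⟨T, by simp [hT], he⟩

lemma exists_mem_of_mem_greedyChosen {h : History n} {e : Sym2 (Fin n)}
    (he : e ∈ greedyChosen ℓ h) : ∃ S ∈ h, e ∈ S := by
  induction h with
  | nil => simp [greedyChosen] at he
  | cons S h ih =>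
    rw [greedyChosen] at he
    split_ifs at he with hS
    · rcases Finset.mem_insert.1 he with rfl | he
      · exact ⟨S, by simp, Subtype.prop _⟩
      · obtain ⟨T, hT, he⟩ := ih he
        exact ⟨T, by simp [hT], he⟩
    · obtain ⟨T, hT, he⟩ := ih he
      exact ⟨T, by simp [hT], he⟩

lemma revealTime_lt {h : History n} {e : Sym2 (Fin n)} (he : ∃ S ∈ h, e ∈ S) :
    revealTime h e < h.length := by
  induction h with
  | nil => simp at he
  | cons S h ih =>
    rw [revealTime, List.length_cons]
    split_ifs with heS
    · omega
    · obtain ⟨T, hT, he⟩ := he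
      rcases List.mem_cons.1 hT with rfl | hT
      · exact absurd he heS
      · exact (ih ⟨T, hT, he⟩).trans (by omega)

lemma isGreedyRun_greedyChosen (hr : 1 ≤ r) {h : History n} (hv : IsValid r h) :
    IsGreedyRun ℓ r (greedyChosen ℓ h) (revealTime h) (fun e => revealedAt h (revealTime h e)) := by
  induction h with
  | nil =>
    constructor <;> simp [greedyChosen]
  | cons S h ih =>
    obtain ⟨hSo, hv⟩ := hv
    have ih := ih hv
    obtain ⟨hSu, hSc⟩ := Finset.mem_powersetCard.1 hSo
    have hS : S.Nonempty := Finset.card_pos.1 (by omega)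
    set e₀ : Sym2 (Fin n) := (greedyPick ℓ (greedyChosen ℓ h) S hS).1 with he₀
    have he₀S : e₀ ∈ S := Subtype.prop _
    have hG : greedyChosen ℓ (S :: h) = insert e₀ (greedyChosen ℓ h) := by
      rw [greedyChosen, dif_pos hS]
    have hnot : ∀ e, (∃ T ∈ h, e ∈ T) → e ∉ S := fun e ⟨T, hT, he⟩ heS =>
      (Finset.mem_filter.1 (hSu heS)).2 T hT he
    have hold : ∀ e ∈ greedyChosen ℓ h, e ∉ S := fun e he =>
      hnot e (exists_mem_of_mem_greedyChosen he)
    have ht₀ : revealTime (S :: h) e₀ = h.length := by rw [revealTime, if_pos he₀S]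
    have ht : ∀ e ∈ greedyChosen ℓ h, revealTime (S :: h) e = revealTime h e := fun e he => by
      rw [revealTime, if_neg (hold e he)]
    have htl : ∀ e ∈ greedyChosen ℓ h, revealTime h e < h.length := fun e he =>
      revealTime_lt (exists_mem_of_mem_greedyChosen he)
    have hs₀ : revealedAt (S :: h) (revealTime (S :: h) e₀) = S := by
      rw [ht₀, revealedAt, if_pos rfl]
    have hs : ∀ e ∈ greedyChosen ℓ h, revealedAt (S :: h) (revealTime (S :: h) e) =
        revealedAt h (revealTime h e) := fun e he => by
      rw [ht e he, revealedAt, if_neg (htl e he).ne]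
    have hd : ∀ i, Disjoint S (revealedAt h i) := fun i =>
      Finset.disjoint_left.2 fun f hf hf' => hnot f (revealedAt_subset h i f hf') hf
    rw [hG]
    refine ⟨?_, ?_, ?_, ?_, ?_⟩
    · intro e he
      rcases Finset.mem_insert.1 he with rfl | he
      · simp only [hs₀, he₀S]
      · simp only [hs e he, ih.mem_step e he]
    · intro e he
      rcases Finset.mem_insert.1 he with rfl | he
      · simp only [hs₀, hSc]
      · simp only [hs e he, ih.card_step e he]
    · intro e he f hf hef
      rcases Finset.mem_insert.1 he with rfl | he <;> rcases Finset.mem_insert.1 hf with rfl | hf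
      · exact absurd rfl hef
      · simp only [hs₀, hs f hf, hd]
      · simp only [hs₀, hs e he, (hd _).symm]
      · simp only [hs e he, hs f hf, ih.disjoint e he f hf hef]
    · intro e he f hf hef
      rcases Finset.mem_insert.1 he with rfl | he <;> rcases Finset.mem_insert.1 hf with rfl | hf
      · rfl
      · rw [ht₀, ht f hf] at hef
        exact absurd hef (htl f hf).ne'
      · rw [ht₀, ht e he] at hef
        exact absurd hef (htl e he).ne
      · rw [ht e he, ht f hf] at hef
        exact ih.time_inj e he f hf hef
    · intro e he b hb f (hf : f ∈ revealedAt (S :: h) (revealTime (S :: h) e))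
      rcases Finset.mem_insert.1 he with rfl | he
      · have hfil : ((insert e₀ (greedyChosen ℓ h)).filter fun g =>
            revealTime (S :: h) g < revealTime (S :: h) e₀) = greedyChosen ℓ h := by
          ext g
          simp only [Finset.mem_filter, Finset.mem_insert, ht₀]
          constructor
          · rintro ⟨rfl | hg, h1⟩
            · exact absurd h1 (by rw [ht₀]; exact lt_irrefl _)
            · exact hg
          · exact fun hg => ⟨Or.inr hg, by rw [ht g hg]; exact htl g hg⟩
        rw [hfil] at hb ⊢
        rw [hs₀] at hf
        exact through_of_le_flowerRank hb.one_le
          (hb.le_flowerRank.trans (flowerRank_greedyPick_le hS hf))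
      · have hfil : ((insert e₀ (greedyChosen ℓ h)).filter fun g =>
            revealTime (S :: h) g < revealTime (S :: h) e) =
            (greedyChosen ℓ h).filter fun g => revealTime h g < revealTime h e := by
          ext g
          simp only [Finset.mem_filter, Finset.mem_insert]
          constructor
          · rintro ⟨rfl | hg, h1⟩
            · rw [ht₀, ht e he] at h1
              exact absurd h1 (htl e he).le.not_gt
            · exact ⟨hg, by rwa [ht g hg, ht e he] at h1⟩
          · exact fun ⟨hg, h1⟩ => ⟨Or.inr hg, by rwa [ht g hg, ht e he]⟩
        rw [hfil] at hb ⊢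
        rw [hs e he] at hf
        exact ih.greedy e he b hb f hf

end GreedyStrategy

/-! ### Copies of `C_{ℓ,k}` and flowers -/

section Copies

variable {ℓ : ℕ} [NeZero ℓ]

/-- The vertices of the `i`-th cycle of `C_{ℓ,k}` in cyclic order, starting at the common vertex. -/
def cycleVertex {k : ℕ} (i : Fin k) (x : ZMod ℓ) : Option (Fin k × Fin (ℓ - 1)) :=
  if h : x.val = 0 then none else some (i, ⟨x.val - 1, by have := ZMod.val_lt x; omega⟩)

lemma cycleVertex_eq {k : ℕ} {i j : Fin k} {x y : ZMod ℓ} (h : cycleVertex i x = cycleVertex j y) :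
    x = y ∧ (x = 0 ∨ i = j) := by
  unfold cycleVertex at h
  split_ifs at h with hx hy hy
  · have hx := (ZMod.val_eq_zero x).1 hx
    have hy := (ZMod.val_eq_zero y).1 hy
    exact ⟨hx.trans hy.symm, Or.inl hx⟩
  · simp only [Option.some.injEq, Prod.mk.injEq, Fin.mk.injEq] at h
    exact ⟨ZMod.val_injective ℓ (by omega), Or.inr h.1⟩

lemma joinedCycles_adj_cycleVertex (hℓ : 3 ≤ ℓ) {k : ℕ} (i : Fin k) (x : ZMod ℓ) :
    (joinedCycles ℓ k).Adj (cycleVertex i x) (cycleVertex i (x + 1)) := by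
  have h1 : (1 : ZMod ℓ).val = 1 := by
    rw [ZMod.val_one_eq_one_mod, Nat.mod_eq_of_lt (by omega)]
  have hx := ZMod.val_lt x
  rw [joinedCycles, SimpleGraph.fromRel_adj]
  refine ⟨fun h => ?_, ?_⟩
  · have h2 : (1 : ZMod ℓ) = 0 := by linear_combination -(cycleVertex_eq h).1
    rw [h2, ZMod.val_zero] at h1
    omega
  have hv := ZMod.val_add x 1
  rw [h1] at hv
  rcases Nat.lt_or_ge (x.val + 1) ℓ with hlt | hge
  · rw [Nat.mod_eq_of_lt hlt] at hv
    by_cases hx0 : x.val = 0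
    · left
      simp [cycleVertex, hx0, hv]
    · left
      simp [cycleVertex, hx0, hv]
      omega
  · have : x.val + 1 = ℓ := by omega
    rw [this, Nat.mod_self] at hv
    right
    have hx0 : x.val ≠ 0 := by omega
    simp [cycleVertex, hx0, hv]
    omega

/-- A graph containing a copy of `C_{ℓ,k}` contains a flower with `k` petals. -/
lemma exists_isFlower_of_not_free (hℓ : 3 ≤ ℓ) {k n : ℕ} {σ : Strategy n} {h : History n}
    (hF : ¬ (joinedCycles ℓ k).Free (playerGraph σ h)) :
    ∃ (v : Fin n) (P : Finset (ZMod ℓ → Fin n)), IsFlower v P ∧ P.card = k ∧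
      flowerEdges P ⊆ chosen σ h := by
  classical
  rw [SimpleGraph.Free, not_not] at hF
  obtain ⟨f⟩ := hF
  have hf := f.injective
  have hinj : Function.Injective fun (i : Fin k) (x : ZMod ℓ) => f (cycleVertex i x) := by
    intro i j hij
    rcases (cycleVertex_eq (hf (congrFun hij 1))).2 with h | h
    · have : Fact (1 < ℓ) := ⟨by omega⟩
      exact absurd h one_ne_zero
    · exact h
  refine ⟨f none, Finset.univ.image fun (i : Fin k) (x : ZMod ℓ) => f (cycleVertex i x),
    ⟨?_, ?_, ?_⟩, ?_, ?_⟩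
  · intro p hp
    obtain ⟨i, -, rfl⟩ := Finset.mem_image.1 hp
    simp [cycleVertex]
  · intro p hp x y hxy
    obtain ⟨i, -, rfl⟩ := Finset.mem_image.1 hp
    exact (cycleVertex_eq (hf hxy)).1
  · intro p hp q hq hpq x y hxy
    obtain ⟨i, -, rfl⟩ := Finset.mem_image.1 hp
    obtain ⟨j, -, rfl⟩ := Finset.mem_image.1 hq
    rcases (cycleVertex_eq (hf hxy)).2 with h | h
    · exact h
    · exact absurd (h ▸ rfl) hpq
  · rw [Finset.card_image_of_injective _ hinj, Finset.card_univ, Fintype.card_fin]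
  · intro e he
    obtain ⟨p, hp, he⟩ := Finset.mem_biUnion.1 he
    obtain ⟨i, -, rfl⟩ := Finset.mem_image.1 hp
    obtain ⟨x, rfl⟩ := mem_petalEdges.1 he
    have := f.toHom.map_adj (joinedCycles_adj_cycleVertex hℓ i x)
    exact_mod_cast ((SimpleGraph.fromEdgeSet_adj _).1 this).1

end Copies

/-! ### The union bound over witnesses -/

section UnionBound

variable {n r : ℕ}

/-- The prescription to reveal the edges of a pattern in certain steps: `φ` places the `s` vertices
of the pattern, `T` lists the numbers of `d` steps, and `g` describes each of the `M` edges by its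
two ends and its step. -/
def prescription {s d M N : ℕ} (φ : Fin s → Fin n) (T : Fin d → Fin N)
    (g : Fin M → Fin s × Fin s × Fin d) : Finset (Sym2 (Fin n) × ℕ) :=
  Finset.univ.image fun i => (s(φ (g i).1, φ (g i).2.1), (T (g i).2.2 : ℕ))

/-- Some prescription of `M` distinct edges on `s` vertices and in `d` steps is met. -/
def MeetsPrescription (s d M N : ℕ) (h : History n) : Prop :=
  ∃ c : (Fin s → Fin n) × (Fin d → Fin N) × (Fin M → Fin s × Fin s × Fin d),
    (prescription c.1 c.2.1 c.2.2).card = M ∧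
      ∀ q ∈ prescription c.1 c.2.1 c.2.2, q.1 ∈ revealedAt h q.2

lemma historyLaw_meetsPrescription_le {K : ℕ} (hK : 0 < K) {N : ℕ}
    (hN : r * N + K ≤ n.choose 2) (s d M : ℕ) :
    (historyLaw n r N).toOuterMeasure {h | MeetsPrescription s d M N h} ≤
      ((n ^ s * (N ^ d * (s * (s * d)) ^ M) : ℕ) : ℝ≥0∞) * ((r : ℝ≥0∞) / K) ^ M := by
  have hsub : {h : History n | MeetsPrescription s d M N h} ⊆
      ⋃ c : (Fin s → Fin n) × (Fin d → Fin N) × (Fin M → Fin s × Fin s × Fin d),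
        {h | (prescription c.1 c.2.1 c.2.2).card = M ∧
          ∀ q ∈ prescription c.1 c.2.1 c.2.2, q.1 ∈ revealedAt h q.2} := fun h ⟨c, hc⟩ =>
    Set.mem_iUnion.2 ⟨c, hc⟩
  refine (MeasureTheory.measure_mono hsub).trans
    ((MeasureTheory.measure_iUnion_fintype_le _ _).trans ?_)
  have hterm : ∀ c : (Fin s → Fin n) × (Fin d → Fin N) × (Fin M → Fin s × Fin s × Fin d),
      (historyLaw n r N).toOuterMeasure {h | (prescription c.1 c.2.1 c.2.2).card = M ∧
          ∀ q ∈ prescription c.1 c.2.1 c.2.2, q.1 ∈ revealedAt h q.2} ≤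
        ((r : ℝ≥0∞) / K) ^ M := by
    intro c
    by_cases hc : (prescription c.1 c.2.1 c.2.2).card = M
    · refine (MeasureTheory.measure_mono fun h hh => hh.2).trans
        ((historyLaw_forall_mem_le hK hN (prescription c.1 c.2.1 c.2.2)).trans ?_)
      rw [hc]
    · simp [hc]
  refine (Finset.sum_le_sum fun c _ => hterm c).trans ?_
  rw [Finset.sum_const, nsmul_eq_mul, Finset.card_univ]
  simp

open Classical in
/-- A witness in a run prescribes the step of each of its edges and of all edges revealed together
with its full edges. -/
lemma meetsPrescription_of_witness {ℓ : ℕ} [NeZero ℓ] {N : ℕ} {h : History n}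
    {G : Finset (Sym2 (Fin n))}
    (hlt : ∀ e ∈ G, revealTime h e < N)
    (hrun : IsGreedyRun ℓ r G (revealTime h) (fun e => revealedAt h (revealTime h e)))
    {J : Witness (Fin n)} (hJ : J.Valid G)
    (hfull : ∀ f ∈ J.full, ∀ e ∈ revealedAt h (revealTime h f), ∀ w ∈ e, w ∈ J.verts) :
    MeetsPrescription J.verts.card J.edges.card (J.edges.card + (r - 1) * J.full.card) N h := by
  set F : Sym2 (Fin n) → Finset (Sym2 (Fin n)) := fun e =>
    if e ∈ J.full then revealedAt h (revealTime h e) else {e} with hF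
  set P : Finset (Sym2 (Fin n) × ℕ) :=
    J.edges.biUnion fun e => (F e).image fun f => (f, revealTime h e) with hP
  have hPc : P.card = J.edges.card + (r - 1) * J.full.card := by
    rw [hP, Finset.card_biUnion]
    · have : ∀ e ∈ J.edges, ((F e).image fun f => (f, revealTime h e)).card =
          1 + if e ∈ J.full then r - 1 else 0 := by
        intro e he
        rw [Finset.card_image_of_injective _ fun a b hab => (Prod.mk.inj hab).1, hF]
        have h1 : (revealedAt h (revealTime h e)).card = r := hrun.card_step e (hJ.edges_sub he)
        have h2 := Finset.card_pos.2 ⟨e, hrun.mem_step e (hJ.edges_sub he)⟩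
        by_cases hef : e ∈ J.full
        · simp only [hef, if_true]
          omega
        · simp [hef]
      rw [Finset.sum_congr rfl this, Finset.sum_add_distrib, ← Finset.sum_filter,
        Finset.filter_mem_eq_inter, Finset.inter_eq_right.2 hJ.full_sub]
      simp [mul_comm]
    · intro e he f hf hef
      refine Finset.disjoint_left.2 fun q hq hq' => hef ?_
      obtain ⟨a, -, rfl⟩ := Finset.mem_image.1 hq
      obtain ⟨b, -, hb⟩ := Finset.mem_image.1 hq'
      exact hrun.time_inj e (hJ.edges_sub he) f (hJ.edges_sub hf) (Prod.mk.inj hb).2.symm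
  have hPr : ∀ q ∈ P, q.1 ∈ revealedAt h q.2 := by
    intro q hq
    obtain ⟨e, he, hq⟩ := Finset.mem_biUnion.1 hq
    obtain ⟨f, hf, rfl⟩ := Finset.mem_image.1 hq
    simp only [hF] at hf
    split_ifs at hf
    · exact hf
    · rw [Finset.mem_singleton.1 hf]
      exact hrun.mem_step e (hJ.edges_sub he)
  set φ : Fin J.verts.card → Fin n := fun i => J.verts.equivFin.symm i with hφ
  set T : Fin J.edges.card → Fin N := fun i =>
    ⟨revealTime h (J.edges.equivFin.symm i), hlt _ (hJ.edges_sub (Subtype.prop _))⟩ with hT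
  have hφs : ∀ w ∈ J.verts, ∃ i, φ i = w := fun w hw =>
    ⟨J.verts.equivFin ⟨w, hw⟩, by simp [hφ]⟩
  have hTs : ∀ e ∈ J.edges, ∃ i, (T i : ℕ) = revealTime h e := fun e he =>
    ⟨J.edges.equivFin ⟨e, he⟩, by simp [hT]⟩
  have hcode : ∀ q : P, ∃ g : Fin J.verts.card × Fin J.verts.card × Fin J.edges.card,
      (s(φ g.1, φ g.2.1), (T g.2.2 : ℕ)) = q.1 := by
    rintro ⟨q, hq⟩
    obtain ⟨e, he, hq⟩ := Finset.mem_biUnion.1 hq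
    obtain ⟨f, hf, rfl⟩ := Finset.mem_image.1 hq
    have hfV : ∀ w ∈ f, w ∈ J.verts := by
      simp only [hF] at hf
      split_ifs at hf with hef
      · exact hfull e hef f hf
      · rw [Finset.mem_singleton.1 hf]
        exact hJ.mem_verts e he
    obtain ⟨c, hc⟩ := hTs e he
    induction f using Sym2.ind with
    | _ a b =>
      obtain ⟨i, hi⟩ := hφs a (hfV a (Sym2.mem_mk_left _ _))
      obtain ⟨j, hj⟩ := hφs b (hfV b (Sym2.mem_mk_right _ _))
      exact ⟨(i, j, c), by simp only [hi, hj, hc]⟩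
  choose g hg using hcode
  rw [← hPc]
  have hPp : prescription φ T (fun i => g (P.equivFin.symm i)) = P := by
    ext q
    rw [prescription, Finset.mem_image]
    constructor
    · rintro ⟨i, -, rfl⟩
      rw [hg]
      exact Subtype.prop _
    · exact fun hq => ⟨P.equivFin ⟨q, hq⟩, Finset.mem_univ _, by rw [hg]; simp⟩
  exact ⟨(φ, T, fun i => g (P.equivFin.symm i)), by rw [hPp], by rw [hPp]; exact hPr⟩

/-- The numbers of vertices, edges and full edges of the witnesses that have at most `L` vertices,
at least one edge, and a nonpositive exponent. -/
noncomputable def witnessShapes (x : ℝ) (r L : ℕ) : Finset (ℕ × ℕ × ℕ) :=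
  open Classical in
  (Finset.range (L + 1) ×ˢ Finset.range ((L + 1) ^ 2 + 1) ×ˢ Finset.range ((L + 1) ^ 2 + 1)).filter
    fun t => 1 ≤ t.2.1 ∧ (t.1 : ℝ) - x * t.2.1 - 2 * ((r : ℝ) - 1) * t.2.2 ≤ 0

lemma one_le_survivalProb_add_sum {ℓ : ℕ} [NeZero ℓ] {x : ℝ} (hx : 0 ≤ x) (hx1 : x ≤ 1)
    (hℓ : 3 ≤ ℓ) {k : ℕ} (hk : 1 ≤ k) (hr : 1 ≤ r)
    (hA : ∀ a < k, 0 ≤ treeExponent ℓ r (1 - x) a ∧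
      ℓ * (1 - x) ≤ 1 + treeExponent ℓ r (1 - x) a)
    (hAk : treeExponent ℓ r (1 - x) k ≤ 0)
    {K : ℕ} (hK : 0 < K) {N : ℕ} (hN : r * N + K ≤ n.choose 2) :
    1 ≤ survivalProb (joinedCycles ℓ k) r (greedyStrategy ℓ n) N +
      ∑ t ∈ witnessShapes x r (1 + k * ℓ + growth ℓ r k),
        ((n ^ t.1 * (N ^ t.2.1 * (t.1 * (t.1 * t.2.1)) ^ (t.2.1 + (r - 1) * t.2.2)) : ℕ) : ℝ≥0∞) *
          ((r : ℝ≥0∞) / K) ^ (t.2.1 + (r - 1) * t.2.2) := by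
  set L := 1 + k * ℓ + growth ℓ r k with hL
  have h1 : (historyLaw n r N).toOuterMeasure
      ({h | h.length = N ∧ (joinedCycles ℓ k).Free (playerGraph (greedyStrategy ℓ n) h)} ∪
        ⋃ t ∈ witnessShapes x r L,
          {h | MeetsPrescription t.1 t.2.1 (t.2.1 + (r - 1) * t.2.2) N h}) = 1 := by
    rw [PMF.toOuterMeasure_apply_eq_one_iff]
    intro h hh
    obtain ⟨hv, hl⟩ := isValid_of_mem_support (by omega) hh
    by_cases hF : (joinedCycles ℓ k).Free (playerGraph (greedyStrategy ℓ n) h)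
    · exact Or.inl ⟨hl, hF⟩
    right
    obtain ⟨v, P, hP, hPc, hPG⟩ := exists_isFlower_of_not_free hℓ hF
    rw [chosen_greedyStrategy] at hPG
    have hrun := isGreedyRun_greedyChosen (ℓ := ℓ) hr hv
    obtain ⟨J, hJ, hne, hfull, hexp, hcard⟩ := exists_witness hx hx1 hℓ hk hA hrun hP hPc hPG
    refine Set.mem_iUnion₂.2 ⟨(J.verts.card, J.edges.card, J.full.card), ?_, ?_⟩
    · have hE : J.edges.card ≤ (L + 1) ^ 2 := by
        have hsub : J.edges ⊆ J.verts.sym2 := fun e he =>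
          Finset.mem_sym2_iff.2 (hJ.mem_verts e he)
        refine (Finset.card_le_card hsub).trans ?_
        rw [Finset.card_sym2]
        exact (Nat.choose_le_pow _ _).trans (Nat.pow_le_pow_left (by omega) 2)
      have hQ := Finset.card_le_card hJ.full_sub
      simp only [witnessShapes, Finset.mem_filter, Finset.mem_product, Finset.mem_range]
      exact ⟨⟨by omega, by omega, by omega⟩, Finset.card_pos.2 hne, hexp.trans hAk⟩
    · refine meetsPrescription_of_witness (fun e he => ?_) hrun hJ hfull
      rw [← hl]
      exact revealTime_lt (exists_mem_of_mem_greedyChosen he)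
  rw [← h1]
  refine (MeasureTheory.measure_union_le _ _).trans (add_le_add le_rfl ?_)
  exact (MeasureTheory.measure_biUnion_finset_le _ _).trans
    (Finset.sum_le_sum fun t _ => historyLaw_meetsPrescription_le hK hN _ _ _)

end UnionBound

/-! ### The exponent of the lower bound -/

section Exponents

/-- The exponent `x` such that the lower bound on the threshold is `n ^ (2 - x)`. -/
noncomputable def lowerExponent (ℓ k r : ℕ) : ℝ :=
  (((r : ℝ) * ((ℓ : ℝ) - 2) + 1) * ((r : ℝ) ^ k - 1) + (r : ℝ) - 1) /
    (((r : ℝ) * ((ℓ : ℝ) - 1) + 1) * ((r : ℝ) ^ k - 1))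

lemma lowerBound_eq (ℓ k r n : ℕ) : lowerBound ℓ k r n = (n : ℝ) ^ (2 - lowerExponent ℓ k r) := rfl

variable {ℓ k r : ℕ}

lemma one_le_pow_sub_one (hr : 2 ≤ r) (hk : 1 ≤ k) : (1 : ℝ) ≤ (r : ℝ) ^ k - 1 := by
  have hR : (2 : ℝ) ≤ r := by exact_mod_cast hr
  have := le_self_pow₀ (show (1 : ℝ) ≤ r by linarith) (show k ≠ 0 by omega)
  linarith

lemma mul_one_sub_lowerExponent (hℓ : 3 ≤ ℓ) (hk : 1 ≤ k) (hr : 2 ≤ r) :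
    ((r : ℝ) * ((ℓ : ℝ) - 1) + 1) * (1 - lowerExponent ℓ k r) =
      r - ((r : ℝ) - 1) / ((r : ℝ) ^ k - 1) := by
  have hR : (2 : ℝ) ≤ r := by exact_mod_cast hr
  have hl : (3 : ℝ) ≤ ℓ := by exact_mod_cast hℓ
  have hB := one_le_pow_sub_one hr hk
  have hc : 0 < (r : ℝ) * ((ℓ : ℝ) - 1) + 1 := by nlinarith
  have hB0 : (r : ℝ) ^ k - 1 ≠ 0 := by linarith
  rw [lowerExponent]
  generalize (r : ℝ) ^ k - 1 = B at *
  field_simp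
  ring

lemma lowerExponent_nonneg (hℓ : 3 ≤ ℓ) (hk : 1 ≤ k) (hr : 2 ≤ r) : 0 ≤ lowerExponent ℓ k r := by
  have hR : (2 : ℝ) ≤ r := by exact_mod_cast hr
  have hl : (3 : ℝ) ≤ ℓ := by exact_mod_cast hℓ
  have hB := one_le_pow_sub_one hr hk
  have h1 : 0 ≤ (r : ℝ) * ((ℓ : ℝ) - 2) := by nlinarith
  have h2 : 0 ≤ (r : ℝ) * ((ℓ : ℝ) - 1) := by nlinarith
  have h3 : 0 ≤ ((r : ℝ) * ((ℓ : ℝ) - 2) + 1) * ((r : ℝ) ^ k - 1) :=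
    mul_nonneg (by linarith) (by linarith)
  refine div_nonneg (by linarith) (mul_nonneg (by linarith) (by linarith))

lemma one_sub_lowerExponent_nonneg (hℓ : 3 ≤ ℓ) (hk : 1 ≤ k) (hr : 2 ≤ r) :
    0 ≤ 1 - lowerExponent ℓ k r := by
  have hR : (2 : ℝ) ≤ r := by exact_mod_cast hr
  have hl : (3 : ℝ) ≤ ℓ := by exact_mod_cast hℓ
  have hB := one_le_pow_sub_one hr hk
  have hc : 0 < (r : ℝ) * ((ℓ : ℝ) - 1) + 1 := by nlinarith
  have h := mul_one_sub_lowerExponent hℓ hk hr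
  have h1 : ((r : ℝ) - 1) / ((r : ℝ) ^ k - 1) ≤ (r : ℝ) - 1 :=
    div_le_self (by linarith) hB
  by_contra hneg
  have := mul_neg_of_pos_of_neg hc (not_le.1 hneg)
  linarith

lemma mul_one_sub_lowerExponent_le (hℓ : 3 ≤ ℓ) (hk : 1 ≤ k) (hr : 2 ≤ r) :
    ℓ * (1 - lowerExponent ℓ k r) ≤ 3 / 2 := by
  have hR : (2 : ℝ) ≤ r := by exact_mod_cast hr
  have hl : (3 : ℝ) ≤ ℓ := by exact_mod_cast hℓ
  have hB := one_le_pow_sub_one hr hk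
  have hc : 0 < (r : ℝ) * ((ℓ : ℝ) - 1) + 1 := by nlinarith
  have h := mul_one_sub_lowerExponent hℓ hk hr
  have h1 : 0 ≤ ((r : ℝ) - 1) / ((r : ℝ) ^ k - 1) := div_nonneg (by linarith) (by linarith)
  have h2 : ((r : ℝ) * ((ℓ : ℝ) - 1) + 1) * (ℓ * (1 - lowerExponent ℓ k r)) ≤
      ((r : ℝ) * ((ℓ : ℝ) - 1) + 1) * (3 / 2) := by
    calc ((r : ℝ) * ((ℓ : ℝ) - 1) + 1) * (ℓ * (1 - lowerExponent ℓ k r))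
        = ℓ * (r - ((r : ℝ) - 1) / ((r : ℝ) ^ k - 1)) := by rw [← h]; ring
      _ ≤ ℓ * r := mul_le_mul_of_nonneg_left (by linarith) (by linarith)
      _ ≤ _ := by nlinarith
  exact le_of_mul_le_mul_left h2 hc

lemma treeExponent_lowerExponent (hℓ : 3 ≤ ℓ) (hk : 1 ≤ k) (hr : 2 ≤ r) (b : ℕ) :
    treeExponent ℓ r (1 - lowerExponent ℓ k r) b =
      1 - ((r : ℝ) ^ b - 1) / ((r : ℝ) ^ k - 1) := by
  have hB := one_le_pow_sub_one hr hk
  have hB0 : (r : ℝ) ^ k - 1 ≠ 0 := by linarith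
  induction b with
  | zero => simp [treeExponent]
  | succ b ih =>
    have h := mul_one_sub_lowerExponent hℓ hk hr
    rw [treeExponent, ih]
    generalize 1 - lowerExponent ℓ k r = y at *
    have h' : (ℓ : ℝ) * y + ((r : ℝ) - 1) * (((ℓ : ℝ) - 1) * y) =
        r - ((r : ℝ) - 1) / ((r : ℝ) ^ k - 1) := by rw [← h]; ring
    have h'' : ((r : ℝ) ^ (b + 1) - 1) / ((r : ℝ) ^ k - 1) =
        r * (((r : ℝ) ^ b - 1) / ((r : ℝ) ^ k - 1)) + ((r : ℝ) - 1) / ((r : ℝ) ^ k - 1) := by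
      rw [pow_succ]; field_simp; ring
    rw [h'']
    linear_combination h'

lemma half_le_treeExponent (hℓ : 3 ≤ ℓ) (hr : 2 ≤ r) {a : ℕ} (ha : a < k) :
    1 / 2 ≤ treeExponent ℓ r (1 - lowerExponent ℓ k r) a := by
  have hR : (2 : ℝ) ≤ r := by exact_mod_cast hr
  have hB := one_le_pow_sub_one hr (show 1 ≤ k by omega)
  rw [treeExponent_lowerExponent hℓ (by omega) hr]
  have h1 : (r : ℝ) ^ (a + 1) ≤ (r : ℝ) ^ k := pow_le_pow_right₀ (by linarith) ha
  have h2 : 0 < (r : ℝ) ^ a := by positivity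
  have h3 : ((r : ℝ) ^ a - 1) / ((r : ℝ) ^ k - 1) ≤ 1 / 2 := by
    rw [div_le_iff₀ (by linarith)]
    rw [pow_succ] at h1
    nlinarith
  linarith

end Exponents

/-! ### Asymptotics and threshold functions -/

section Asymptotics

variable {ℓ k r : ℕ}

/-- The expected number of copies of a witness with nonpositive exponent tends to `0`. -/
lemma tendsto_expected_copies {x : ℝ} {N : ℕ → ℕ}
    (hN : (fun n => (N n : ℝ)) =o[atTop] fun n : ℕ => (n : ℝ) ^ (2 - x)) (hr : 1 ≤ r)
    {K : ℕ → ℕ} (hK : ∀ᶠ n : ℕ in atTop, (n : ℝ) ^ 2 / 8 ≤ K n) {s d q : ℕ} (hd : 1 ≤ d)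
    (hμ : (s : ℝ) - x * d - 2 * ((r : ℝ) - 1) * q ≤ 0) (c : ℕ) :
    Tendsto (fun n => ((n ^ s * (N n ^ d * c) : ℕ) : ℝ≥0∞) *
      ((r : ℝ≥0∞) / K n) ^ (d + (r - 1) * q)) atTop (𝓝 0) := by
  set M := d + (r - 1) * q with hM
  have hε := hN.tendsto_div_nhds_zero
  have hlim : Tendsto (fun n : ℕ => ENNReal.ofReal
      ((c : ℝ) * (8 * r) ^ M * ((N n : ℝ) / (n : ℝ) ^ (2 - x)) ^ d)) atTop (𝓝 0) := by
    have h1 := (hε.pow d).const_mul ((c : ℝ) * (8 * r) ^ M)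
    rw [zero_pow (by omega), mul_zero] at h1
    simpa using ENNReal.tendsto_ofReal h1
  refine tendsto_of_tendsto_of_tendsto_of_le_of_le' tendsto_const_nhds hlim
    (Eventually.of_forall fun _ => zero_le) ?_
  filter_upwards [hK, eventually_ge_atTop 1] with n hKn hn
  have hn1 : (1 : ℝ) ≤ n := by exact_mod_cast hn
  have hn0 : (0 : ℝ) < n := by linarith
  have hK0 : (0 : ℝ) < K n := lt_of_lt_of_le (by positivity) hKn
  have heq : ((n ^ s * (N n ^ d * c) : ℕ) : ℝ≥0∞) * ((r : ℝ≥0∞) / K n) ^ M =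
      ENNReal.ofReal ((n ^ s * (N n ^ d * c) : ℕ) * ((r : ℝ) / K n) ^ M) := by
    rw [ENNReal.ofReal_mul (by positivity), ENNReal.ofReal_pow (by positivity),
      ENNReal.ofReal_div_of_pos hK0]
    simp only [ENNReal.ofReal_natCast]
  rw [heq]
  refine ENNReal.ofReal_le_ofReal ?_
  have h1 : (r : ℝ) / K n ≤ 8 * r * (n : ℝ) ^ (-2 : ℝ) := by
    rw [Real.rpow_neg hn0.le, Real.rpow_two, ← div_eq_mul_inv, div_le_div_iff₀ hK0 (by positivity)]
    have hr0 : (0 : ℝ) ≤ r := by positivity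
    nlinarith
  have h2 : ((r : ℝ) / K n) ^ M ≤ (8 * r) ^ M * (n : ℝ) ^ (-2 * (M : ℝ)) := by
    refine (pow_le_pow_left₀ (by positivity) h1 M).trans (le_of_eq ?_)
    rw [mul_pow, Real.rpow_mul hn0.le, Real.rpow_natCast]
  have h3 : (N n : ℝ) ^ d =
      ((N n : ℝ) / (n : ℝ) ^ (2 - x)) ^ d * (n : ℝ) ^ ((2 - x) * (d : ℝ)) := by
    rw [Real.rpow_mul hn0.le, Real.rpow_natCast, ← mul_pow, div_mul_cancel₀]
    exact (Real.rpow_pos_of_pos hn0 _).ne'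
  have h4 : (n : ℝ) ^ (s : ℝ) * (n : ℝ) ^ ((2 - x) * (d : ℝ)) * (n : ℝ) ^ (-2 * (M : ℝ)) ≤ 1 := by
    rw [← Real.rpow_add hn0, ← Real.rpow_add hn0]
    refine Real.rpow_le_one_of_one_le_of_nonpos hn1 ?_
    have hMr : (M : ℝ) = d + ((r : ℝ) - 1) * q := by
      rw [hM]; push_cast [Nat.cast_sub hr]; ring
    rw [hMr]
    linarith
  have hε0 : 0 ≤ (N n : ℝ) / (n : ℝ) ^ (2 - x) := by positivity
  push_cast
  rw [← Real.rpow_natCast (n : ℝ) s]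
  calc (n : ℝ) ^ (s : ℝ) * ((N n : ℝ) ^ d * c) * ((r : ℝ) / K n) ^ M
      ≤ (n : ℝ) ^ (s : ℝ) * ((N n : ℝ) ^ d * c) * ((8 * r) ^ M * (n : ℝ) ^ (-2 * (M : ℝ))) :=
        mul_le_mul_of_nonneg_left h2 (by positivity)
    _ = ((c : ℝ) * (8 * r) ^ M * ((N n : ℝ) / (n : ℝ) ^ (2 - x)) ^ d) *
          ((n : ℝ) ^ (s : ℝ) * (n : ℝ) ^ ((2 - x) * (d : ℝ)) * (n : ℝ) ^ (-2 * (M : ℝ))) := by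
        rw [h3]; ring
    _ ≤ ((c : ℝ) * (8 * r) ^ M * ((N n : ℝ) / (n : ℝ) ^ (2 - x)) ^ d) * 1 :=
        mul_le_mul_of_nonneg_left h4 (by positivity)
    _ = _ := mul_one _

/-- The greedy strategy survives asymptotically fewer steps than the lower bound. -/
lemma canSurvive_of_isLittleO (hℓ : 3 ≤ ℓ) (hk : 1 ≤ k) (hr : 2 ≤ r) {N : ℕ → ℕ}
    (hN : (fun n => (N n : ℝ)) =o[atTop] lowerBound ℓ k r) :
    CanSurvive (joinedCycles ℓ k) r N := by
  have : NeZero ℓ := ⟨by omega⟩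
  set x := lowerExponent ℓ k r with hx
  have hx0 : 0 ≤ x := lowerExponent_nonneg hℓ hk hr
  have hx1 : 0 ≤ 1 - x := one_sub_lowerExponent_nonneg hℓ hk hr
  have hr0 : (0 : ℝ) < r := by exact_mod_cast (show 0 < r by omega)
  have hA : ∀ a < k, 0 ≤ treeExponent ℓ r (1 - x) a ∧
      ℓ * (1 - x) ≤ 1 + treeExponent ℓ r (1 - x) a := by
    intro a ha
    have h1 := half_le_treeExponent hℓ hr ha
    have h2 := mul_one_sub_lowerExponent_le hℓ hk hr
    constructor <;> linarith
  have hAk : treeExponent ℓ r (1 - x) k ≤ 0 := by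
    have hB := one_le_pow_sub_one hr hk
    rw [treeExponent_lowerExponent hℓ hk hr, div_self (by linarith), sub_self]
  have hunseen : ∀ᶠ n : ℕ in atTop, (r * N n : ℝ) + (n : ℝ) ^ 2 / 8 ≤ (n.choose 2 : ℕ) := by
    filter_upwards [hN.def (show (0 : ℝ) < 1 / (8 * r) by positivity), eventually_ge_atTop 2]
      with n hn hn2
    have hn2' : (2 : ℝ) ≤ n := by exact_mod_cast hn2
    rw [Real.norm_natCast, lowerBound_eq, Real.norm_of_nonneg (by positivity)] at hn
    have h1 : (n : ℝ) ^ (2 - x) ≤ (n : ℝ) ^ 2 := by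
      rw [← Real.rpow_two]
      exact Real.rpow_le_rpow_of_exponent_le (by linarith) (by linarith)
    have h2 : (r * N n : ℝ) ≤ (n : ℝ) ^ 2 / 8 := by
      calc (r * N n : ℝ) ≤ r * (1 / (8 * r) * (n : ℝ) ^ (2 - x)) :=
            mul_le_mul_of_nonneg_left hn hr0.le
        _ = (n : ℝ) ^ (2 - x) / 8 := by field_simp
        _ ≤ _ := by linarith
    rw [Nat.cast_choose_two]
    nlinarith
  set K : ℕ → ℕ := fun n => n.choose 2 - r * N n with hK
  have hNK : ∀ᶠ n : ℕ in atTop, r * N n + K n ≤ n.choose 2 ∧ (n : ℝ) ^ 2 / 8 ≤ K n := by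
    filter_upwards [hunseen] with n hn
    have h1 : r * N n ≤ n.choose 2 := by
      have : (r * N n : ℝ) ≤ (n.choose 2 : ℕ) := by linarith [sq_nonneg (n : ℝ)]
      exact_mod_cast this
    refine ⟨by simp only [hK]; omega, ?_⟩
    simp only [hK]
    rw [Nat.cast_sub h1]
    push_cast
    linarith
  set L := 1 + k * ℓ + growth ℓ r k with hL
  have hsum : Tendsto (fun n => ∑ t ∈ witnessShapes x r L,
        ((n ^ t.1 * (N n ^ t.2.1 * (t.1 * (t.1 * t.2.1)) ^ (t.2.1 + (r - 1) * t.2.2)) : ℕ) :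
          ℝ≥0∞) * ((r : ℝ≥0∞) / K n) ^ (t.2.1 + (r - 1) * t.2.2)) atTop (𝓝 0) := by
    rw [← Finset.sum_const_zero (s := witnessShapes x r L)]
    refine tendsto_finsetSum _ fun t ht => ?_
    obtain ⟨-, hd, hμ⟩ := Finset.mem_filter.1 ht
    exact tendsto_expected_copies hN (by omega) (hNK.mono fun n h => h.2) hd hμ _
  refine ⟨fun n => greedyStrategy ℓ n, ?_⟩
  have hlow := ENNReal.Tendsto.sub (tendsto_const_nhds (x := (1 : ℝ≥0∞))) hsum
    (Or.inl ENNReal.one_ne_top)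
  rw [tsub_zero] at hlow
  refine tendsto_of_tendsto_of_tendsto_of_le_of_le' hlow tendsto_const_nhds ?_
    (Eventually.of_forall fun n => toOuterMeasure_le_one _ _)
  filter_upwards [hNK, eventually_ge_atTop 1] with n hn hn1
  have hn1' : (1 : ℝ) ≤ n := by exact_mod_cast hn1
  have hK0 : 0 < K n := by
    have : (0 : ℝ) < K n := lt_of_lt_of_le (by positivity) hn.2
    exact_mod_cast this
  exact tsub_le_iff_right.2 (one_le_survivalProb_add_sum hx0 (by linarith) hℓ hk (by omega) hA hAk
    hK0 hn.1)

lemma tendsto_lowerBound (hℓ : 3 ≤ ℓ) (hk : 1 ≤ k) (hr : 2 ≤ r) :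
    Tendsto (lowerBound ℓ k r) atTop atTop := by
  have h := one_sub_lowerExponent_nonneg hℓ hk hr
  exact (tendsto_rpow_atTop (show 0 < 2 - lowerExponent ℓ k r by linarith)).comp
    tendsto_natCast_atTop_atTop

/-- Up to a constant factor, a threshold function is an upper bound for every function `L` that tends
to infinity and below which the player survives. Otherwise `√(L * N₀)` would, along a subsequence,
be asymptotically smaller than `L` and larger than `N₀`. -/
lemma IsThreshold.isBigO {V : Type*} {F : SimpleGraph V} {N₀ L : ℕ → ℝ} (h₀ : IsThreshold F r N₀)
    (hL : Tendsto L atTop atTop)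
    (hsurv : ∀ N : ℕ → ℕ, (fun n => (N n : ℝ)) =o[atTop] L → CanSurvive F r N) :
    L =O[atTop] N₀ := by
  classical
  by_contra hnot
  have hfreq : ∀ j : ℕ, ∃ᶠ n in atTop, 0 < N₀ n ∧ 0 < L n ∧ (j : ℝ) * N₀ n < L n := by
    intro j hj
    refine hnot (IsBigO.of_bound j ?_)
    filter_upwards [hj, h₀.eventually_pos, hL.eventually_gt_atTop 0] with n hn hpos hLn
    rw [Real.norm_of_nonneg hpos.le, Real.norm_of_nonneg hLn.le]
    by_contra hlt
    exact hn ⟨hpos, hLn, not_le.1 hlt⟩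
  obtain ⟨φ, hφ, hφP⟩ := extraction_forall_of_frequently hfreq
  set m : ℕ → ℕ := fun n => ⌈√(L n * N₀ n)⌉₊ with hm
  set N₁ : ℕ → ℕ := fun n => if n ∈ Set.range φ then m n + 1 else 0 with hN₁
  set N₂ : ℕ → ℕ := fun n => if n ∈ Set.range φ then m n else ⌈n * N₀ n⌉₊ with hN₂
  have h1 : (fun n => (N₁ n : ℝ)) =o[atTop] L := by
    refine IsLittleO.of_bound fun c hc => ?_
    obtain ⟨J, hJ⟩ := exists_nat_gt (4 / c ^ 2)
    filter_upwards [eventually_ge_atTop (φ J), hL.eventually_ge_atTop (4 / c)] with n hn hLn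
    have hL0 : 0 < L n := lt_of_lt_of_le (by positivity) hLn
    rw [Real.norm_natCast, Real.norm_of_nonneg hL0.le]
    by_cases hmem : n ∈ Set.range φ
    · obtain ⟨j, rfl⟩ := hmem
      obtain ⟨hp, -, hlt⟩ := hφP j
      have hj : 4 / c ^ 2 < j := hJ.trans_le (by exact_mod_cast hφ.le_iff_le.1 hn)
      rw [div_lt_iff₀ (by positivity)] at hj
      have hs : √(L (φ j) * N₀ (φ j)) ≤ c / 2 * L (φ j) := by
        refine Real.sqrt_le_iff.2 ⟨by positivity, ?_⟩
        have h2 : 4 * N₀ (φ j) ≤ c ^ 2 * L (φ j) := by nlinarith [sq_nonneg c]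
        nlinarith
      have hceil := Nat.ceil_lt_add_one (Real.sqrt_nonneg (L (φ j) * N₀ (φ j)))
      rw [div_le_iff₀ hc] at hLn
      simp only [hN₁, hm, Set.mem_range_self, if_true]
      push_cast
      linarith
    · simp only [hN₁, hmem, if_false]
      push_cast
      positivity
  have h2 : N₀ =o[atTop] fun n => (N₂ n : ℝ) := by
    refine IsLittleO.of_bound fun c hc => ?_
    obtain ⟨J, hJ⟩ := exists_nat_gt (1 / c ^ 2)
    obtain ⟨J', hJ'⟩ := exists_nat_gt (1 / c)
    filter_upwards [eventually_ge_atTop (φ J), eventually_ge_atTop J', h₀.eventually_pos]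
      with n hn hn' hpos
    rw [Real.norm_natCast, Real.norm_of_nonneg hpos.le]
    by_cases hmem : n ∈ Set.range φ
    · obtain ⟨j, rfl⟩ := hmem
      obtain ⟨hp, hLp, hlt⟩ := hφP j
      have hj : 1 / c ^ 2 < j := hJ.trans_le (by exact_mod_cast hφ.le_iff_le.1 hn)
      rw [div_lt_iff₀ (by positivity)] at hj
      have hs : N₀ (φ j) / c ≤ √(L (φ j) * N₀ (φ j)) := by
        refine Real.le_sqrt_of_sq_le ?_
        rw [div_pow, div_le_iff₀ (by positivity)]
        have h2 : N₀ (φ j) ≤ c ^ 2 * L (φ j) := by nlinarith [sq_nonneg c]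
        nlinarith
      have hceil := Nat.le_ceil (√(L (φ j) * N₀ (φ j)))
      simp only [hN₂, hm, Set.mem_range_self, if_true]
      rw [div_le_iff₀ hc] at hs
      nlinarith
    · simp only [hN₂, hmem, if_false]
      have hceil := Nat.le_ceil ((n : ℝ) * N₀ n)
      have h3 : 1 / c < n := hJ'.trans_le (by exact_mod_cast hn')
      rw [div_lt_iff₀ hc] at h3
      nlinarith
  obtain ⟨σ, hσ⟩ := hsurv N₁ h1
  have h3 := (hσ.comp hφ.tendsto_atTop)
  have h4 := ((h₀.cannotSurvive N₂ h2 σ).comp hφ.tendsto_atTop)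
  have heq : (fun n => survivalProb F r (σ n) (N₁ n)) ∘ φ =
      (fun n => survivalProb F r (σ n) (N₂ n + 1)) ∘ φ := by
    funext j
    simp [hN₁, hN₂]
  rw [heq] at h3
  exact one_ne_zero (tendsto_nhds_unique h3 h4)

end Asymptotics

end Achlioptas

theorem mainTheorem7 (ℓ k r : ℕ) (hℓ : 3 ≤ ℓ) (hk : 3 ≤ k) (hr : 2 ≤ r) :
    (∀ N : ℕ → ℕ,
      (fun n => (N n : ℝ)) =o[atTop] Achlioptas.lowerBound ℓ k r →
        Achlioptas.CanSurvive (joinedCycles ℓ k) r N) ∧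
    (∀ N₀ : ℕ → ℝ,
      Achlioptas.IsThreshold (joinedCycles ℓ k) r N₀ →
        Achlioptas.lowerBound ℓ k r =O[atTop] N₀) := by
  have hsurv := fun (N : ℕ → ℕ)
      (hN : (fun n => (N n : ℝ)) =o[atTop] Achlioptas.lowerBound ℓ k r) =>
    Achlioptas.canSurvive_of_isLittleO hℓ (show 1 ≤ k by omega) hr hN
  exact ⟨hsurv, fun N₀ h₀ =>
    h₀.isBigO (Achlioptas.tendsto_lowerBound hℓ (by omega) hr) hsurv⟩
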